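/- **Setting.** Fix real matrices $A\in\mathbb R^{n\times n}$, $B\in\mathbb R^{n\times m}$, $C\in\mathbb R^{p\times n}$, $E\in\mathbb R^{n\times w}$, $G\in\mathbb R^{p\times w}$, $S\in\mathbb R^{w\times w}$. For $N$ agents consider, for $i=1,\dots,N$ and $k\ge 0$, $$x_i(k+1)=Ax_i(k)+Bu_i(k)+E\omega_i(k),\quad y_i(k)=Cx_i(k)+G\omega_i(k),\quad \omega_i(k+1)=S\omega_i(k).$$ The communication graph is a weighted directed graph on $\{1,\dots,N\}$ with weights $a_{ij}\ge 0$, $a_{ii}=0$; there is an edge from $j$ to $i$ iff $a_{ij}>0$. Agent $i$ knows an upper bound $\bar d_i\ge\sum_j a_{ij}$ on its in-degree. Put $d_{ij}=a_{ij}/(1+\bar d_i)$ for $j\neq i$. Agent $i$ receives $$\zeta_i(k)=\sum_{j\ne i}d_{ij}\,(y_i(k)-y_j(k)),\qquad \hat\zeta_i(k)=\sum_{j\ne i}d_{ij}\,(\eta_i(k)-\eta_j(k)),$$ where $\eta_i$ is a variable of agent $i$'s protocol. A linear dynamic protocol is given by constant matrices $A_c,B_c,C_c,F_c,M_c$ and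 reads $$x_{i,c}(k+1)=A_cx_{i,c}(k)+B_c\zeta_i(k)+C_c\hat\zeta_i(k),\quad u_i(k)=F_cx_{i,c}(k),\quad \eta_i(k)=M_cx_{i,c}(k).$$ It *achieves scalable output synchronization* if $\lim_{k\to\infty}(y_i(k)-y_j(k))=0$ for all $i,j$, for every $N$, every graph on $N$ nodes that contains a directed spanning tree, all bounds $\bar d_i$ as above, and all initial conditions of the agents, the protocols and the exosystems. The protocol matrices do not depend on $N$, on the graph or on the bounds. A real square matrix is *Schur stable* if all its eigenvalues are in the open unit disc. **Assumption 1.** 1. (A1.1) All eigenvalues of $A$ are in the closed unit disc. 2. (A1.2) All eigenvalues of $S$ are on the unit circle. 3. (A1.3) $(A,B)$ is stabilizable. 4. (A1.4) $\left(\begin{pmatrix}C&-G\end{pmatrix},\begin{pmatrix}A&-E\\0&S\end{pmatrix}\right)$ is detectable. 5. (A1.5) $(C,A,B)$ is right-invertible, i.e. its transfer matrix has a right inverse over the rational functions. 6. (A1.6) $(C,A,B)$ has no invariant zeros on or outside the unit circle, and no invariant zero of $(C,A,B)$ is an eigenvalue of $S$. **Theorem 1.** Let Assumption 1 hold. Then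 some linear dynamic protocol achieves scalable output synchronization. Specifically: 1. The regulation equations $\Pi S=A\Pi+B\Gamma+E$, $C\Pi+G=0$ have a solution $(\Pi,\Gamma)$ with $\Pi\in\mathbb R^{n\times w}$, $\Gamma\in\mathbb R^{m\times w}$. 2. For each such solution there are $B_p\in\mathbb R^{w\times m}$ and $D_p\in\mathbb R^{m\times m}$ for which the pre-compensator $p_i(k+1)=Sp_i(k)+B_pv_i(k)$, $u_i(k)=\Gamma p_i(k)+D_pv_i(k)$ is invertible (its transfer matrix is invertible over the rational functions) and of minimum phase (its invariant zeros are in the open unit disc). 3. For each such choice put $\tilde A=\begin{pmatrix}A&B\Gamma\\0&S\end{pmatrix}$, $\tilde B=\begin{pmatrix}BD_p\\B_p\end{pmatrix}$, $\tilde C=\begin{pmatrix}C&0\end{pmatrix}$. There are matrices $K$, $H$ for which $\tilde A-\tilde BK$ and $\tilde A-H\tilde C$ are Schur stable. 4. For all such $\Pi,\Gamma,B_p,D_p,K,H$, the protocol with state $(p_i,\hat x_i,\chi_i)$ and exchanged variable $\eta_i=\chi_i$, $$\begin{aligned}p_i(k+1)&=Sp_i(k)-B_pK\chi_i(k),\\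 \hat x_i(k+1)&=\tilde A\hat x_i(k)-\tilde BK\hat\zeta_i(k)+H(\zeta_i(k)-\tilde C\hat x_i(k)),\\ \chi_i(k+1)&=\tilde A\chi_i(k)-\tilde BK\chi_i(k)+\tilde A(\hat x_i(k)-\hat\zeta_i(k)),\\ u_i(k)&=\Gamma p_i(k)-D_pK\chi_i(k),\end{aligned}$$ achieves scalable output synchronization. -/

import Mathlib

open Filter Topology
open scoped Matrix Polynomial

noncomputable section

namespace ScalableSync

/-! Linear system theory (discrete time). -/

/-- The complex eigenvalues of a real square matrix. -/
def eigenvalues {ι : Type} [Fintype ι] [DecidableEq ι] (M : Matrix ι ι ℝ) : Set ℂ :=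
  spectrum ℂ (M.map (algebraMap ℝ ℂ))

/-- All eigenvalues lie in the open unit disc. -/
def IsSchur {ι : Type} [Fintype ι] [DecidableEq ι] (M : Matrix ι ι ℝ) : Prop :=
  ∀ z ∈ eigenvalues M, ‖z‖ < 1

/-- `(A, B)` is stabilizable: some static state feedback makes it Schur stable. -/
def Stabilizable {ι μ : Type} [Fintype ι] [DecidableEq ι] [Fintype μ]
    (A : Matrix ι ι ℝ) (B : Matrix ι μ ℝ) : Prop :=
  ∃ K : Matrix μ ι ℝ, IsSchur (A - B * K)

/-- `(C, A)` is detectable: some output injection makes it Schur stable. -/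
def Detectable {ι π : Type} [Fintype ι] [DecidableEq ι] [Fintype π]
    (C : Matrix π ι ℝ) (A : Matrix ι ι ℝ) : Prop :=
  ∃ H : Matrix ι π ℝ, IsSchur (A - H * C)

/-- The transfer matrix `C (zI - A)⁻¹ B + D`, over the field of real rational functions. -/
def transferMatrix {ι μ π : Type} [Fintype ι] [DecidableEq ι]
    (A : Matrix ι ι ℝ) (B : Matrix ι μ ℝ) (C : Matrix π ι ℝ) (D : Matrix π μ ℝ) :
    Matrix π μ (RatFunc ℝ) :=
  C.map (RatFunc.C) *
      ((RatFunc.X : RatFunc ℝ) • (1 : Matrix ι ι (RatFunc ℝ)) - A.map (RatFunc.C))⁻¹ *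
      B.map (RatFunc.C) + D.map (RatFunc.C)

/-- The system is right-invertible: its transfer matrix has a right inverse over the field of
rational functions. -/
def RightInvertible {ι μ π : Type} [Fintype ι] [DecidableEq ι] [Fintype μ] [DecidableEq π]
    (A : Matrix ι ι ℝ) (B : Matrix ι μ ℝ) (C : Matrix π ι ℝ) (D : Matrix π μ ℝ) : Prop :=
  ∃ R : Matrix μ π (RatFunc ℝ), transferMatrix A B C D * R = 1

/-- The (square) system is invertible: its transfer matrix is invertible over the field of
rational functions. -/
def InvertibleSystem {ι μ : Type} [Fintype ι] [DecidableEq ι] [Fintype μ] [DecidableEq μ]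
    (A : Matrix ι ι ℝ) (B : Matrix ι μ ℝ) (C : Matrix μ ι ℝ) (D : Matrix μ μ ℝ) : Prop :=
  IsUnit (transferMatrix A B C D)

/-- The Rosenbrock system matrix `[zI - A, -B; C, D]`, a matrix of polynomials in `z`. -/
def systemMatrix {ι μ π : Type} [Fintype ι] [DecidableEq ι]
    (A : Matrix ι ι ℝ) (B : Matrix ι μ ℝ) (C : Matrix π ι ℝ) (D : Matrix π μ ℝ) :
    Matrix (ι ⊕ π) (ι ⊕ μ) ℝ[X] :=
  Matrix.fromBlocks
    ((Polynomial.X : ℝ[X]) • (1 : Matrix ι ι ℝ[X]) - A.map Polynomial.C)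
    (-B.map Polynomial.C) (C.map Polynomial.C) (D.map Polynomial.C)

/-- The normal rank of the system matrix: its rank over the field of rational functions. -/
def normalRank {ι μ π : Type} [Fintype ι] [DecidableEq ι] [Fintype μ]
    (A : Matrix ι ι ℝ) (B : Matrix ι μ ℝ) (C : Matrix π ι ℝ) (D : Matrix π μ ℝ) : ℕ :=
  ((systemMatrix A B C D).map (algebraMap ℝ[X] (RatFunc ℝ))).rank

/-- `z` is an invariant zero: the system matrix evaluated at `z` has rank below normal rank. -/
def IsInvariantZero {ι μ π : Type} [Fintype ι] [DecidableEq ι] [Fintype μ]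
    (A : Matrix ι ι ℝ) (B : Matrix ι μ ℝ) (C : Matrix π ι ℝ) (D : Matrix π μ ℝ) (z : ℂ) : Prop :=
  ((systemMatrix A B C D).map (Polynomial.aeval z)).rank < normalRank A B C D

/-- Minimum phase: all invariant zeros lie in the open unit disc. -/
def MinimumPhase {ι μ π : Type} [Fintype ι] [DecidableEq ι] [Fintype μ]
    (A : Matrix ι ι ℝ) (B : Matrix ι μ ℝ) (C : Matrix π ι ℝ) (D : Matrix π μ ℝ) : Prop :=
  ∀ z : ℂ, IsInvariantZero A B C D z → ‖z‖ < 1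

/-! Agents, communication graphs and protocols. -/

/-- The matrices of the agents `x⁺ = A x + B u + E ω`, `y = C x + G ω` and of the exosystem
`ω⁺ = S ω`, with `x ∈ ℝⁿ`, `u ∈ ℝᵐ`, `y ∈ ℝᵖ`, `ω ∈ ℝʷ`. -/
structure AgentModel (n m p w : ℕ) where
  A : Matrix (Fin n) (Fin n) ℝ
  B : Matrix (Fin n) (Fin m) ℝ
  C : Matrix (Fin p) (Fin n) ℝ
  E : Matrix (Fin n) (Fin w) ℝ
  G : Matrix (Fin p) (Fin w) ℝ
  S : Matrix (Fin w) (Fin w) ℝ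

/-- The standing assumptions on the agents and the exosystem. -/
structure AgentModel.Assumptions {n m p w : ℕ} (P : AgentModel n m p w) : Prop where
  weakly_unstable : ∀ z ∈ eigenvalues P.A, ‖z‖ ≤ 1
  exosystem_unit_circle : ∀ z ∈ eigenvalues P.S, ‖z‖ = 1
  stabilizable : Stabilizable P.A P.B
  detectable : Detectable (Matrix.fromCols P.C (-P.G)) (Matrix.fromBlocks P.A (-P.E) 0 P.S)
  right_invertible : RightInvertible P.A P.B P.C 0
  zeros_stable : ∀ z : ℂ, IsInvariantZero P.A P.B P.C 0 z → ‖z‖ < 1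
  zeros_disjoint : ∀ z : ℂ, IsInvariantZero P.A P.B P.C 0 z → z ∉ eigenvalues P.S

/-- A weighted directed graph without self-loops; `weight i j > 0` means that there is an edge
from `j` to `i`. -/
structure WeightedDigraph (N : ℕ) where
  weight : Matrix (Fin N) (Fin N) ℝ
  nonneg : ∀ i j, 0 ≤ weight i j
  loopless : ∀ i, weight i i = 0

/-- The weighted in-degree of a node. -/
def WeightedDigraph.inDegree {N : ℕ} (g : WeightedDigraph N) (i : Fin N) : ℝ :=
  ∑ j, g.weight i j

/-- The graph contains a directed spanning tree: a set `T` of edges (`T j i` is the edge from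
`j` to `i`) in which the root `r` has no parent, every other node has exactly one parent, and
every node is reached from `r`. -/
def WeightedDigraph.HasDirectedSpanningTree {N : ℕ} (g : WeightedDigraph N) : Prop :=
  ∃ (r : Fin N) (T : Fin N → Fin N → Prop),
    (∀ j i, T j i → 0 < g.weight i j) ∧ (∀ j, ¬ T j r) ∧ (∀ i, i ≠ r → ∃! j, T j i) ∧
      ∀ i, Relation.ReflTransGen T r i

/-- The localized information `∑ⱼ dᵢⱼ (zᵢ - zⱼ)` with `dᵢⱼ = aᵢⱼ / (1 + d̄ᵢ)` for `j ≠ i`, where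
`d̄ᵢ` is the bound on the in-degree that agent `i` uses. -/
def localInfo {N : ℕ} {ν : Type} (g : WeightedDigraph N) (dbar : Fin N → ℝ)
    (z : Fin N → ν → ℝ) (i : Fin N) : ν → ℝ :=
  ∑ j, (g.weight i j / (1 + dbar i)) • (z i - z j)

/-- A linear dynamic protocol `x_c⁺ = A_c x_c + B_c ζ + C_c ζ̂`, `u = F_c x_c`, with `η = M_c x_c`
the variable that is exchanged. The states are in `ℝ^κ` and the exchanged variables in `ℝ^ν`. -/
structure LinearProtocol (m p : ℕ) (κ ν : Type) where
  Ac : Matrix κ κ ℝ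
  Bc : Matrix κ (Fin p) ℝ
  Cc : Matrix κ ν ℝ
  Fc : Matrix (Fin m) κ ℝ
  Mc : Matrix ν κ ℝ

/-- The measured output `y = C x + G ω` of an agent. -/
def AgentModel.output {n m p w : ℕ} (P : AgentModel n m p w)
    (x : Fin n → ℝ) (ω : Fin w → ℝ) : Fin p → ℝ :=
  P.C *ᵥ x + P.G *ᵥ ω

/-- `x`, `xc`, `ω` (time, agent) are the trajectories of the agents, of their protocols and of
their exosystems in the closed loop over the graph `g`. -/
structure IsTrajectory {n m p w N : ℕ} {κ ν : Type} [Fintype κ] [Fintype ν]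
    (P : AgentModel n m p w) (Q : LinearProtocol m p κ ν)
    (g : WeightedDigraph N) (dbar : Fin N → ℝ)
    (x : ℕ → Fin N → Fin n → ℝ) (xc : ℕ → Fin N → κ → ℝ) (ω : ℕ → Fin N → Fin w → ℝ) :
    Prop where
  exosystem : ∀ k i, ω (k + 1) i = P.S *ᵥ ω k i
  agent : ∀ k i, x (k + 1) i = P.A *ᵥ x k i + P.B *ᵥ (Q.Fc *ᵥ xc k i) + P.E *ᵥ ω k i
  protocol : ∀ k i, xc (k + 1) i = Q.Ac *ᵥ xc k i
    + Q.Bc *ᵥ localInfo g dbar (fun j => P.output (x k j) (ω k j)) i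
    + Q.Cc *ᵥ localInfo g dbar (fun j => Q.Mc *ᵥ xc k j) i

/-- The protocol achieves scalable output synchronization: for every number of agents, every
graph that contains a directed spanning tree, all upper bounds on the in-degrees, and all initial
conditions of agents, protocols and exosystems, all output differences tend to zero. -/
def AchievesScalableSync {n m p w : ℕ} {κ ν : Type} [Fintype κ] [Fintype ν]
    (P : AgentModel n m p w) (Q : LinearProtocol m p κ ν) : Prop :=
  ∀ (N : ℕ) (g : WeightedDigraph N), g.HasDirectedSpanningTree →
    ∀ dbar : Fin N → ℝ, (∀ i, g.inDegree i ≤ dbar i) →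
    ∀ (x : ℕ → Fin N → Fin n → ℝ) (xc : ℕ → Fin N → κ → ℝ) (ω : ℕ → Fin N → Fin w → ℝ),
      IsTrajectory P Q g dbar x xc ω →
      ∀ i j, Tendsto (fun k => P.output (x k i) (ω k i) - P.output (x k j) (ω k j))
        atTop (𝓝 0)

/-- The scalable output synchronization problem is solvable for the given agent model. -/
def ScalableSyncSolvable {n m p w : ℕ} (P : AgentModel n m p w) : Prop :=
  ∃ (nc nη : ℕ) (Q : LinearProtocol m p (Fin nc) (Fin nη)), AchievesScalableSync P Q

/-! The protocol design. -/

/-- The regulation equations `Π S = A Π + B Γ + E`, `C Π + G = 0`. -/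
def RegulationEquations {n m p w : ℕ} (P : AgentModel n m p w)
    (Pi : Matrix (Fin n) (Fin w) ℝ) (Gam : Matrix (Fin m) (Fin w) ℝ) : Prop :=
  Pi * P.S = P.A * Pi + P.B * Gam + P.E ∧ P.C * Pi + P.G = 0

/-- The requirement on the pre-compensator `p⁺ = S p + B_p v`, `u = Γ p + D_p v`. -/
def AdmissiblePrecompensator {n m p w : ℕ} (P : AgentModel n m p w)
    (Gam : Matrix (Fin m) (Fin w) ℝ) (Bp : Matrix (Fin w) (Fin m) ℝ)
    (Dp : Matrix (Fin m) (Fin m) ℝ) : Prop :=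
  InvertibleSystem P.S Bp Gam Dp ∧ MinimumPhase P.S Bp Gam Dp

/-- The state matrix of the cascade of pre-compensator and agent. -/
def cascadeA {n m p w : ℕ} (P : AgentModel n m p w) (Gam : Matrix (Fin m) (Fin w) ℝ) :
    Matrix (Fin n ⊕ Fin w) (Fin n ⊕ Fin w) ℝ :=
  Matrix.fromBlocks P.A (P.B * Gam) 0 P.S

/-- The input matrix of the cascade. -/
def cascadeB {n m p w : ℕ} (P : AgentModel n m p w) (Bp : Matrix (Fin w) (Fin m) ℝ)
    (Dp : Matrix (Fin m) (Fin m) ℝ) : Matrix (Fin n ⊕ Fin w) (Fin m) ℝ :=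
  Matrix.fromRows (P.B * Dp) Bp

/-- The output matrix of the cascade. -/
def cascadeC {n m p w : ℕ} (P : AgentModel n m p w) : Matrix (Fin p) (Fin n ⊕ Fin w) ℝ :=
  Matrix.fromCols P.C 0

/-- The overall protocol, with state `(p, x̂, χ)` and exchanged variable `η = χ`:
`p⁺ = S p - B_p K χ`,
`x̂⁺ = Ã x̂ - B̃ K ζ̂ + H (ζ - C̃ x̂)`,
`χ⁺ = Ã χ - B̃ K χ + Ã (x̂ - ζ̂)`,
`u = Γ p - D_p K χ`. -/
def overallProtocol {n m p w : ℕ} (P : AgentModel n m p w)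
    (Gam : Matrix (Fin m) (Fin w) ℝ) (Bp : Matrix (Fin w) (Fin m) ℝ)
    (Dp : Matrix (Fin m) (Fin m) ℝ) (K : Matrix (Fin m) (Fin n ⊕ Fin w) ℝ)
    (H : Matrix (Fin n ⊕ Fin w) (Fin p) ℝ) :
    LinearProtocol m p (Fin w ⊕ ((Fin n ⊕ Fin w) ⊕ (Fin n ⊕ Fin w))) (Fin n ⊕ Fin w) where
  Ac := Matrix.fromBlocks
    P.S (Matrix.fromCols 0 (-(Bp * K)))
    0 (Matrix.fromBlocks
        (cascadeA P Gam - H * cascadeC P) 0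
        (cascadeA P Gam) (cascadeA P Gam - cascadeB P Bp Dp * K))
  Bc := Matrix.fromRows 0 (Matrix.fromRows H 0)
  Cc := Matrix.fromRows 0 (Matrix.fromRows (-(cascadeB P Bp Dp * K)) (-cascadeA P Gam))
  Fc := Matrix.fromCols Gam (Matrix.fromCols 0 (-(Dp * K)))
  Mc := Matrix.fromCols 0 (Matrix.fromCols 0 1)

end ScalableSync

end

/-! Synchronization. Put `ξ_i = (x_i - Π ω_i, p_i - ω_i)`. The regulation equations absorb the
exosystem: `ξ_i⁺ = Ã ξ_i - B̃ K χ_i` and `y_i = C̃ ξ_i`. Write `L` for the map `localInfo`. The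
observer error `e = L ξ - x̂` obeys `e⁺ = (Ã - H C̃) e`, hence vanishes. The exchange of `χ` is
designed so that `δ = ξ - χ` obeys `δ⁺ = Ã (δ - L δ + e)`, where `1 - L` is averaging with a row
stochastic matrix `D`. A spanning tree and positive diagonal entries give some power of `D` a
positive column, so `D ^ k` contracts differences between agents like `ρ ^ k` with `ρ < 1`. The
eigenvalues of `Ã` lie in the closed disc, so `Ã ^ k` grows more slowly than any `s ^ k` with `s >
1`; taking `s ρ < 1` gives `δ_i - δ_j → 0` (`tendsto_sub_of_consensus`). Finally `ξ_i - ξ_j` is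
driven through the Schur matrix `Ã - B̃ K` by `B̃ K (δ_i - δ_j)`, so it vanishes too
(`tendsto_sub_of_observer`). No gain depends on the graph.

Existence of the design. Right-invertibility and the absence of zeros at eigenvalues of `S` make the
Rosenbrock matrix surjective there; the regulation equations are then solved one eigenvalue at a
time, with Cayley–Hamilton removing the final remainder (`exists_sylvester`). Detectability of `(Γ,
S)` yields a pre-compensator with `D_p = 1`. The gains `K` and `H` come from the Hautus test, proved
by moving unstable eigenvalues to zero with real rank one feedbacks. -/

namespace ScalableSync

/-! ### Complex eigenvalues of real matrices. -/

section Spectrum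

variable {ι μ π : Type} [Fintype ι] [DecidableEq ι] [Fintype μ] [Fintype π]

theorem mem_eigenvalues_iff_isRoot {M : Matrix ι ι ℝ} {z : ℂ} :
    z ∈ eigenvalues M ↔ (M.map (algebraMap ℝ ℂ)).charpoly.IsRoot z :=
  Matrix.mem_spectrum_iff_isRoot_charpoly

theorem mem_eigenvalues_iff_det {M : Matrix ι ι ℝ} {z : ℂ} :
    z ∈ eigenvalues M ↔ (Matrix.scalar ι z - M.map (algebraMap ℝ ℂ)).det = 0 := by
  rw [mem_eigenvalues_iff_isRoot, Polynomial.IsRoot.def, Matrix.eval_charpoly]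

theorem mem_eigenvalues_iff_vecMul {M : Matrix ι ι ℝ} {z : ℂ} :
    z ∈ eigenvalues M ↔ ∃ a, a ≠ 0 ∧ a ᵥ* M.map (algebraMap ℝ ℂ) = z • a := by
  rw [mem_eigenvalues_iff_det, ← Matrix.exists_vecMul_eq_zero_iff]
  simp only [Matrix.vecMul_sub, Matrix.scalar_apply, sub_eq_zero, ← Matrix.smul_one_eq_diagonal,
    Matrix.vecMul_smul, Matrix.vecMul_one, eq_comm]

theorem eigenvalues_transpose (M : Matrix ι ι ℝ) : eigenvalues Mᵀ = eigenvalues M := by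
  ext z
  rw [mem_eigenvalues_iff_isRoot, mem_eigenvalues_iff_isRoot, Matrix.transpose_map,
    Matrix.charpoly_transpose]

theorem isSchur_transpose {M : Matrix ι ι ℝ} : IsSchur Mᵀ ↔ IsSchur M := by
  rw [IsSchur, IsSchur, eigenvalues_transpose]

theorem eigenvalues_fromBlocks_zero {κ : Type} [Fintype κ] [DecidableEq κ] (M : Matrix ι ι ℝ)
    (L : Matrix ι κ ℝ) (M' : Matrix κ κ ℝ) :
    eigenvalues (Matrix.fromBlocks M L 0 M') = eigenvalues M ∪ eigenvalues M' := by
  ext z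
  rw [Set.mem_union, mem_eigenvalues_iff_isRoot, mem_eigenvalues_iff_isRoot,
    mem_eigenvalues_iff_isRoot, Matrix.fromBlocks_map,
    Matrix.map_zero _ (map_zero _), Matrix.charpoly_fromBlocks_zero₂₁, Polynomial.root_mul]

theorem stabilizable_transpose_iff {A : Matrix ι ι ℝ} {C : Matrix π ι ℝ} :
    Stabilizable Aᵀ Cᵀ ↔ Detectable C A := by
  constructor
  · rintro ⟨K, hK⟩
    refine ⟨Kᵀ, ?_⟩
    rw [← isSchur_transpose]
    simpa using hK
  · rintro ⟨H, hH⟩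
    refine ⟨Hᵀ, ?_⟩
    rw [← isSchur_transpose]
    simpa using hH

end Spectrum

/-! ### The Hautus tests, by eigenvalue shifting. -/

section Feedback

/-- The state matrix and the input matrix satisfy the Hautus condition outside the open disc. -/
def HautusCondition {ι μ : Type} [Fintype ι] (A : Matrix ι ι ℝ) (B : Matrix ι μ ℝ) : Prop :=
  ∀ z : ℂ, 1 ≤ ‖z‖ → ∀ a : ι → ℂ, a ᵥ* A.map (algebraMap ℝ ℂ) = z • a →
    a ᵥ* B.map (algebraMap ℝ ℂ) = 0 → a = 0

/-- A left vector killed by `B` does not see the feedback. This invariance lets the shifting step be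
iterated. -/
theorem HautusCondition.sub_mul {ι μ : Type} [Fintype ι] [Fintype μ]
    {A : Matrix ι ι ℝ} {B : Matrix ι μ ℝ} (h : HautusCondition A B)
    (K : Matrix μ ι ℝ) : HautusCondition (A - B * K) B := by
  intro z hz a ha hb
  refine h z hz a ?_ hb
  rwa [Matrix.map_sub _ (map_sub _), Matrix.map_mul, Matrix.vecMul_sub, ← Matrix.vecMul_vecMul,
    hb, Matrix.zero_vecMul, sub_zero] at ha

theorem map_vecMul_star {ι μ : Type} [Fintype ι] (A : Matrix ι μ ℝ) (a : ι → ℂ) :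
    star a ᵥ* A.map (algebraMap ℝ ℂ) = star (a ᵥ* A.map (algebraMap ℝ ℂ)) := by
  ext j
  simp [Matrix.vecMul, dotProduct, Pi.star_apply]

variable {ι μ π : Type} [Fintype ι] [DecidableEq ι] [Fintype μ] [Fintype π]

/-- The characteristic polynomial after a rank one update along two left eigenvectors. -/
theorem charpoly_sub_vecMulVec (A : Matrix ι ι ℂ) (b a₁ a₂ : ι → ℂ) (l₁ l₂ t₁ t₂ : ℂ)
    (h₁ : a₁ ᵥ* A = l₁ • a₁) (h₂ : a₂ ᵥ* A = l₂ • a₂) (hb₁ : a₁ ⬝ᵥ b = 1) (hb₂ : a₂ ⬝ᵥ b = 1) :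
    (Polynomial.X - Polynomial.C l₁) * (Polynomial.X - Polynomial.C l₂) *
        (A - Matrix.vecMulVec b (t₁ • a₁ + t₂ • a₂)).charpoly =
      A.charpoly * ((Polynomial.X - Polynomial.C l₁) * (Polynomial.X - Polynomial.C l₂) +
        Polynomial.C t₁ * (Polynomial.X - Polynomial.C l₂) +
        Polynomial.C t₂ * (Polynomial.X - Polynomial.C l₁)) := by
  -- It suffices to compare values off the finite spectrum of `A`, where the resolvent exists and
  -- the matrix determinant lemma applies.
  apply Polynomial.eq_of_infinite_eval_eq
  have hfin : {z : ℂ | A.charpoly.IsRoot z}.Finite :=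
    Polynomial.finite_setOfPred_isRoot A.charpoly_monic.ne_zero
  refine hfin.infinite_compl.mono fun z hz => ?_
  have hz' : (Matrix.scalar ι z - A).det ≠ 0 := by
    rw [← Matrix.eval_charpoly]; exact hz
  set M := Matrix.scalar ι z - A with hM
  have hu : IsUnit M.det := isUnit_iff_ne_zero.mpr hz'
  -- A left eigenvector of `A` is one of the resolvent, so `a M⁻¹ b = 1 / (z - l)`.
  have key : ∀ (a : ι → ℂ) (l : ℂ), a ᵥ* A = l • a → a ⬝ᵥ b = 1 →
      (z - l) * (a ⬝ᵥ (M⁻¹ *ᵥ b)) = 1 := by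
    intro a l ha hb
    have h : a ᵥ* M = (z - l) • a := by
      rw [hM, Matrix.vecMul_sub, ha, Matrix.scalar_apply, ← Matrix.smul_one_eq_diagonal,
        Matrix.vecMul_smul, Matrix.vecMul_one, sub_smul]
    rw [← smul_eq_mul, ← smul_dotProduct, ← h, ← Matrix.dotProduct_mulVec, Matrix.mulVec_mulVec,
      Matrix.mul_nonsing_inv _ hu, Matrix.one_mulVec, hb]
  have k₁ := key a₁ l₁ h₁ hb₁
  have k₂ := key a₂ l₂ h₂ hb₂
  have hdet : (A - Matrix.vecMulVec b (t₁ • a₁ + t₂ • a₂)).charpoly.eval z =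
      M.det * (1 + (t₁ * (a₁ ⬝ᵥ (M⁻¹ *ᵥ b)) + t₂ * (a₂ ⬝ᵥ (M⁻¹ *ᵥ b)))) := by
    rw [Matrix.eval_charpoly, sub_sub_eq_add_sub, add_sub_right_comm, ← hM,
      Matrix.vecMulVec_eq Unit, Matrix.det_add_replicateCol_mul_replicateRow hu]
    congr 1
    rw [Matrix.det_unique, Matrix.add_apply, Matrix.one_apply_eq, Matrix.mul_assoc,
      ← smul_eq_mul, ← smul_eq_mul, ← smul_dotProduct, ← smul_dotProduct, ← add_dotProduct]
    rfl
  simp only [Set.mem_ofPred_eq, Polynomial.eval_mul, Polynomial.eval_add, Polynomial.eval_sub,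
    Polynomial.eval_X, Polynomial.eval_C, hdet]
  rw [Matrix.eval_charpoly, ← hM]
  linear_combination M.det * (t₁ * (z - l₂) * k₁ + t₂ * (z - l₁) * k₂)

open Classical in
/-- The number of roots outside the open unit disc, counted with multiplicity. -/
noncomputable def unstableCount (f : ℂ[X]) : ℕ :=
  f.roots.countP fun z => 1 ≤ ‖z‖

theorem unstableCount_mul {f g : ℂ[X]} (h : f * g ≠ 0) :
    unstableCount (f * g) = unstableCount f + unstableCount g := by
  rw [unstableCount, Polynomial.roots_mul h, Multiset.countP_add]; rfl

theorem unstableCount_X_sub_C_of_le {l : ℂ} (h : 1 ≤ ‖l‖) :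
    unstableCount (Polynomial.X - Polynomial.C l) = 1 := by
  rw [unstableCount, Polynomial.roots_X_sub_C, ← Multiset.cons_zero,
    Multiset.countP_cons_of_pos (p := fun z : ℂ => 1 ≤ ‖z‖) _ h, Multiset.countP_zero]

theorem unstableCount_X : unstableCount Polynomial.X = 0 := by
  rw [unstableCount, Polynomial.roots_X, ← Multiset.cons_zero,
    Multiset.countP_cons_of_neg (p := fun z : ℂ => 1 ≤ ‖z‖) _ (by simp), Multiset.countP_zero]

theorem Stabilizable.hautus {A : Matrix ι ι ℝ} {B : Matrix ι μ ℝ} (h : Stabilizable A B) :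
    HautusCondition A B := by
  obtain ⟨K, hK⟩ := h
  intro z hz a ha hb
  by_contra hne
  refine absurd (hK z (mem_eigenvalues_iff_vecMul.mpr ⟨a, hne, ?_⟩)) (not_lt.mpr hz)
  rw [Matrix.map_sub _ (map_sub _), Matrix.map_mul, Matrix.vecMul_sub, ha, ← Matrix.vecMul_vecMul,
    hb, Matrix.zero_vecMul, sub_zero]

/-- The factor `(X - l)(X - l̄)` has two unstable roots; a suitable `t` leaves at most one after the
update. Pairing `t` with its conjugate keeps the feedback real. -/
theorem exists_shift_polynomial (l : ℂ) (hl : 1 ≤ ‖l‖) : ∃ (t : ℂ) (q : ℂ[X]), q ≠ 0 ∧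
    unstableCount q ≤ 1 ∧
    (Polynomial.X - Polynomial.C l) * (Polynomial.X - Polynomial.C (star l)) +
        Polynomial.C t * (Polynomial.X - Polynomial.C (star l)) +
        Polynomial.C (star t) * (Polynomial.X - Polynomial.C l) = q := by
  by_cases him : l.im = 0
  · have hs : star l = l := Complex.conj_eq_iff_im.mpr him
    have hs2 : star (l / 2) = l / 2 := Complex.conj_eq_iff_im.mpr (by simp [him])
    -- For real `l` both factors coincide; `t + t̄ = l` turns `(X - l)²` into `X (X - l)`, moving a
    -- single root to zero.
    refine ⟨l / 2, Polynomial.X * (Polynomial.X - Polynomial.C l),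
      mul_ne_zero Polynomial.X_ne_zero (Polynomial.X_sub_C_ne_zero l), ?_, ?_⟩
    · rw [unstableCount_mul (mul_ne_zero Polynomial.X_ne_zero (Polynomial.X_sub_C_ne_zero l)),
        unstableCount_X, unstableCount_X_sub_C_of_le hl]
    · rw [hs, hs2]
      have : (Polynomial.C l : ℂ[X]) = Polynomial.C (l / 2) + Polynomial.C (l / 2) := by
        rw [← Polynomial.C_add, add_halves]
      linear_combination (- (Polynomial.X - Polynomial.C l)) * this
  -- For nonreal `l` both roots go to zero: the result is `X²` exactly when `t + t̄ = l + l̄` and `t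
  -- l̄ + t̄ l = l l̄`. These fix the real part of `t` and then, as `l.im ≠ 0`, its imaginary part.
  · set t : ℂ := ⟨l.re, ((l.re ^ 2 + l.im ^ 2) / 2 - l.re ^ 2) / l.im⟩ with ht
    refine ⟨t, Polynomial.X * Polynomial.X,
      mul_ne_zero Polynomial.X_ne_zero Polynomial.X_ne_zero, ?_, ?_⟩
    · rw [unstableCount_mul (mul_ne_zero Polynomial.X_ne_zero Polynomial.X_ne_zero),
        unstableCount_X]
      simp
    · have h1 : t + star t = l + star l := by
        apply Complex.ext <;> simp [ht]
      have h2 : t * star l + star t * l = l * star l := by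
        apply Complex.ext
        · simp [ht]; field_simp; ring
        · simp [ht]; ring
      have h1' := congrArg (Polynomial.C : ℂ → ℂ[X]) h1
      have h2' := congrArg (Polynomial.C : ℂ → ℂ[X]) h2
      simp only [Polynomial.C_add, Polynomial.C_mul] at h1' h2'
      linear_combination Polynomial.X * h1' - h2'

/-- One step of eigenvalue shifting. -/
theorem HautusCondition.exists_unstableCount_lt {A : Matrix ι ι ℝ} {B : Matrix ι μ ℝ}
    (h : HautusCondition A B) (hA : ¬ IsSchur A) : ∃ K : Matrix μ ι ℝ,
      unstableCount ((A - B * K).map (algebraMap ℝ ℂ)).charpoly <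
        unstableCount (A.map (algebraMap ℝ ℂ)).charpoly := by
  classical
  simp only [IsSchur, not_forall, not_lt] at hA
  obtain ⟨l, hl, hl1⟩ := hA
  obtain ⟨a', ha0, ha'⟩ := mem_eigenvalues_iff_vecMul.mp hl
  have hB : a' ᵥ* B.map (algebraMap ℝ ℂ) ≠ 0 := fun h0 => ha0 (h l hl1 a' ha' h0)
  obtain ⟨j, hj⟩ := Function.ne_iff.mp hB
  set c : ℂ := (a' ᵥ* B.map (algebraMap ℝ ℂ)) j with hc
  have hc0 : c ≠ 0 := hj
  set a : ι → ℂ := c⁻¹ • a' with ha_def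
  have ha : a ᵥ* A.map (algebraMap ℝ ℂ) = l • a := by
    rw [ha_def, Matrix.smul_vecMul, ha', smul_comm]
  have haB : (a ᵥ* B.map (algebraMap ℝ ℂ)) j = 1 := by
    rw [ha_def, Matrix.smul_vecMul, Pi.smul_apply, ← hc, smul_eq_mul, inv_mul_cancel₀ hc0]
  have hsa : star a ᵥ* A.map (algebraMap ℝ ℂ) = star l • star a := by
    rw [map_vecMul_star, ha, star_smul]
  have hsaB : (star a ᵥ* B.map (algebraMap ℝ ℂ)) j = 1 := by
    rw [map_vecMul_star, Pi.star_apply, haB, star_one]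
  obtain ⟨t, q, hq0, hq1, hq⟩ := exists_shift_polynomial l hl1
  -- Feedback through the input `j` that the eigenvector sees; the row `2 Re (t a)` is `t a + t̄ ā`,
  -- a combination of the left eigenvectors for `l` and `l̄`.
  refine ⟨Matrix.vecMulVec (Pi.single j 1) fun i => 2 * (t * a i).re, ?_⟩
  have hupd : (A - B * Matrix.vecMulVec (Pi.single j 1) fun i => 2 * (t * a i).re).map
      (algebraMap ℝ ℂ) = A.map (algebraMap ℝ ℂ) -
        Matrix.vecMulVec ((B.map (algebraMap ℝ ℂ)).col j) (t • a + star t • star a) := by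
    rw [Matrix.map_sub _ (map_sub _), Matrix.mul_vecMulVec, Matrix.mulVec_single_one]
    congr 1
    ext i k
    simp only [Matrix.map_apply, Matrix.vecMulVec_apply, Matrix.col_apply, Pi.add_apply,
      Pi.smul_apply, smul_eq_mul, Pi.star_apply, Complex.coe_algebraMap]
    rw [← star_mul', Complex.star_def, Complex.add_conj]
    push_cast; ring
  have hcp := charpoly_sub_vecMulVec (A.map (algebraMap ℝ ℂ)) ((B.map (algebraMap ℝ ℂ)).col j)
    a (star a) l (star l) t (star t) ha hsa haB hsaB
  rw [← hupd, hq] at hcp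
  have h1 := (A.map (algebraMap ℝ ℂ)).charpoly_monic.ne_zero
  have h2 := ((A - B * Matrix.vecMulVec (Pi.single j 1) fun i => 2 * (t * a i).re).map
      (algebraMap ℝ ℂ)).charpoly_monic.ne_zero
  have h3 := Polynomial.X_sub_C_ne_zero l
  have h4 := Polynomial.X_sub_C_ne_zero (star l)
  -- Counting unstable roots: `2 + new = old + count q`, and `count q ≤ 1`.
  have := congrArg unstableCount hcp
  rw [unstableCount_mul (mul_ne_zero (mul_ne_zero h3 h4) h2), unstableCount_mul (mul_ne_zero h3 h4),
    unstableCount_mul (mul_ne_zero h1 hq0), unstableCount_X_sub_C_of_le hl1,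
    unstableCount_X_sub_C_of_le (by rwa [norm_star])] at this
  omega

/-- The Hautus test for stabilizability. -/
theorem HautusCondition.stabilizable {A : Matrix ι ι ℝ} {B : Matrix ι μ ℝ}
    (h : HautusCondition A B) : Stabilizable A B := by
  induction hn : unstableCount (A.map (algebraMap ℝ ℂ)).charpoly using Nat.strong_induction_on
    generalizing A with
  | _ n ih =>
    by_cases hA : IsSchur A
    · exact ⟨0, by simpa using hA⟩
    · obtain ⟨K, hK⟩ := h.exists_unstableCount_lt hA
      obtain ⟨K', hK'⟩ := ih _ (hn ▸ hK) (h.sub_mul K) rfl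
      exact ⟨K + K', by rwa [Matrix.mul_add, ← sub_sub]⟩

theorem detectable_of_hautus {A : Matrix ι ι ℝ} {C : Matrix π ι ℝ}
    (h : ∀ z : ℂ, 1 ≤ ‖z‖ → ∀ v : ι → ℂ, A.map (algebraMap ℝ ℂ) *ᵥ v = z • v →
      C.map (algebraMap ℝ ℂ) *ᵥ v = 0 → v = 0) : Detectable C A := by
  rw [← stabilizable_transpose_iff]
  apply HautusCondition.stabilizable
  intro z hz a ha hb
  rw [Matrix.transpose_map, Matrix.vecMul_transpose] at ha hb
  exact h z hz a ha hb

theorem Detectable.hautus {A : Matrix ι ι ℝ} {C : Matrix π ι ℝ} (h : Detectable C A)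
    {z : ℂ} (hz : 1 ≤ ‖z‖) {v : ι → ℂ} (hv : A.map (algebraMap ℝ ℂ) *ᵥ v = z • v)
    (hC : C.map (algebraMap ℝ ℂ) *ᵥ v = 0) : v = 0 := by
  refine (stabilizable_transpose_iff.mpr h).hautus z hz v ?_ ?_ <;>
    rwa [Matrix.transpose_map, Matrix.vecMul_transpose]

end Feedback

/-! ### Full row rank of the Rosenbrock matrix, and systems with feedthrough one. -/

section Rank

theorem systemMatrix_map {ι μ π : Type} [Fintype ι] [DecidableEq ι] {R : Type*} [CommRing R]
    (A : Matrix ι ι ℝ) (B : Matrix ι μ ℝ)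
    (C : Matrix π ι ℝ) (D : Matrix π μ ℝ) (f : ℝ[X] →+* R) :
    (systemMatrix A B C D).map f = Matrix.fromBlocks
      (f Polynomial.X • (1 : Matrix ι ι R) - A.map (f.comp Polynomial.C))
      (-B.map (f.comp Polynomial.C)) (C.map (f.comp Polynomial.C))
      (D.map (f.comp Polynomial.C)) := by
  rw [systemMatrix, Matrix.fromBlocks_map]
  congr 1
  · ext i j
    by_cases h : i = j <;> simp [h]
  · ext i j
    simp

/-- The Rosenbrock matrix at a complex number. -/
theorem systemMatrix_aeval {ι μ π : Type} [Fintype ι] [DecidableEq ι] (A : Matrix ι ι ℝ)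
    (B : Matrix ι μ ℝ)
    (C : Matrix π ι ℝ) (D : Matrix π μ ℝ) (z : ℂ) :
    (systemMatrix A B C D).map (Polynomial.aeval z) = Matrix.fromBlocks
      (z • (1 : Matrix ι ι ℂ) - A.map (algebraMap ℝ ℂ)) (-B.map (algebraMap ℝ ℂ))
      (C.map (algebraMap ℝ ℂ)) (D.map (algebraMap ℝ ℂ)) := by
  have h := systemMatrix_map A B C D (Polynomial.aeval z : ℝ[X] →ₐ[ℝ] ℂ).toRingHom
  have hC : (Polynomial.aeval z : ℝ[X] →ₐ[ℝ] ℂ).toRingHom.comp Polynomial.C = algebraMap ℝ ℂ := by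
    ext x; simp
  rw [hC] at h
  simpa using h

variable {ι μ π : Type} [Fintype ι] [DecidableEq ι] [Fintype μ] [Fintype π]

theorem rank_eq_card_iff_mulVec_surjective {K : Type*} [Field K] (M : Matrix π μ K) :
    M.rank = Fintype.card π ↔ Function.Surjective M.mulVec := by
  rw [Matrix.rank, ← Module.finrank_fintype_fun_eq_card (R := K) (η := π), ← Matrix.coe_mulVecLin,
    ← LinearMap.range_eq_top]
  exact ⟨Submodule.eq_top_of_finrank_eq, fun h => by rw [h, finrank_top]⟩

theorem eq_zero_of_vecMul_eq_zero {K : Type*} [Field K] {M : Matrix π μ K}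
    (hM : Function.Surjective M.mulVec) {a : π → K} (ha : a ᵥ* M = 0) : a = 0 := by
  classical
  ext i
  obtain ⟨v, hv⟩ := hM (Pi.single i 1)
  have : a ⬝ᵥ (M *ᵥ v) = 0 := by rw [Matrix.dotProduct_mulVec, ha, zero_dotProduct]
  rw [hv] at this
  simpa using this

theorem isUnit_det_ratFunc (A : Matrix ι ι ℝ) :
    IsUnit ((RatFunc.X : RatFunc ℝ) • (1 : Matrix ι ι (RatFunc ℝ)) - A.map RatFunc.C).det := by
  have : (RatFunc.X : RatFunc ℝ) • (1 : Matrix ι ι (RatFunc ℝ)) - A.map RatFunc.C =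
      A.charmatrix.map (algebraMap ℝ[X] (RatFunc ℝ)) := by
    ext i j
    by_cases h : i = j <;> simp [h]
  rw [this, ← RingHom.mapMatrix_apply, ← RingHom.map_det, isUnit_iff_ne_zero]
  exact (map_ne_zero_iff _ (IsFractionRing.injective _ _)).mpr A.charpoly_monic.ne_zero

theorem normalRank_of_mul_eq_one [DecidableEq π] (A : Matrix ι ι ℝ) (B : Matrix ι μ ℝ)
    (C : Matrix π ι ℝ) (D : Matrix π μ ℝ) (R : Matrix μ π (RatFunc ℝ))
    (hR : transferMatrix A B C D * R = 1) :
    normalRank A B C D = Fintype.card (ι ⊕ π) := by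
  rw [normalRank, rank_eq_card_iff_mulVec_surjective]
  have hC : (algebraMap ℝ[X] (RatFunc ℝ)).comp Polynomial.C = RatFunc.C := by
    ext x; simp
  have hs := systemMatrix_map A B C D (algebraMap ℝ[X] (RatFunc ℝ))
  rw [hC, RatFunc.algebraMap_X] at hs
  rw [hs]
  rw [transferMatrix] at hR
  set M := (RatFunc.X : RatFunc ℝ) • (1 : Matrix ι ι (RatFunc ℝ)) - A.map RatFunc.C with hM
  have hdet : IsUnit M.det := isUnit_det_ratFunc A
  intro y
  set f := y ∘ Sum.inl with hf
  set g := y ∘ Sum.inr with hg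
  set B' := B.map (RatFunc.C (K := ℝ))
  set C' := C.map (RatFunc.C (K := ℝ))
  set D' := D.map (RatFunc.C (K := ℝ))
  -- Eliminating the state by `x = M⁻¹ (f + B u)` leaves an equation for `u` whose matrix is the
  -- transfer matrix; `R` solves it.
  set u := R *ᵥ (g - C' *ᵥ (M⁻¹ *ᵥ f)) with hu
  refine ⟨Sum.elim (M⁻¹ *ᵥ (f + B' *ᵥ u)) u, ?_⟩
  rw [Matrix.fromBlocks_mulVec]
  have h1 : M *ᵥ (M⁻¹ *ᵥ (f + B' *ᵥ u)) + (-B') *ᵥ u = f := by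
    rw [Matrix.mulVec_mulVec, Matrix.mul_nonsing_inv _ hdet, Matrix.one_mulVec, Matrix.neg_mulVec,
      add_neg_cancel_right]
  have h2 : C' *ᵥ (M⁻¹ *ᵥ (f + B' *ᵥ u)) + D' *ᵥ u = g := by
    have : (C' * M⁻¹ * B' + D') *ᵥ u = g - C' *ᵥ (M⁻¹ *ᵥ f) := by
      rw [hu, Matrix.mulVec_mulVec, hR, Matrix.one_mulVec]
    rw [Matrix.add_mulVec, ← Matrix.mulVec_mulVec, ← Matrix.mulVec_mulVec] at this
    rw [Matrix.mulVec_add, Matrix.mulVec_add, add_assoc, this, add_sub_cancel]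
  simp only [Sum.elim_comp_inl, Sum.elim_comp_inr, h1, h2]
  exact Sum.elim_comp_inl_inr y

theorem systemMatrix_mulVec_surjective [DecidableEq π] {A : Matrix ι ι ℝ} {B : Matrix ι μ ℝ}
    {C : Matrix π ι ℝ} {D : Matrix π μ ℝ} (hR : RightInvertible A B C D) {z : ℂ}
    (hz : ¬ IsInvariantZero A B C D z) :
    Function.Surjective ((systemMatrix A B C D).map (Polynomial.aeval z)).mulVec := by
  obtain ⟨R, hR⟩ := hR
  rw [← rank_eq_card_iff_mulVec_surjective]
  refine le_antisymm (Matrix.rank_le_card_height _) ?_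
  rw [← normalRank_of_mul_eq_one A B C D R hR]
  exact not_lt.mp hz

theorem InvertibleSystem.rightInvertible [DecidableEq μ] {A : Matrix ι ι ℝ} {B : Matrix ι μ ℝ}
    {C : Matrix μ ι ℝ} {D : Matrix μ μ ℝ} (h : InvertibleSystem A B C D) :
    RightInvertible A B C D := by
  obtain ⟨R, hR⟩ := IsUnit.exists_right_inv h
  exact ⟨R, hR⟩

/-- The system with direct feedthrough `1` is invertible. -/
theorem invertibleSystem_one [DecidableEq μ] (A : Matrix ι ι ℝ) (B : Matrix ι μ ℝ)
    (C : Matrix μ ι ℝ) : InvertibleSystem A B C 1 := by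
  have hM := isUnit_det_ratFunc A
  have hN := isUnit_det_ratFunc (A - B * C)
  rw [InvertibleSystem, transferMatrix, Matrix.isUnit_iff_isUnit_det,
    Matrix.map_one _ (map_zero _) (map_one _), add_comm, Matrix.mul_assoc,
    Matrix.det_one_add_mul_comm]
  set M := (RatFunc.X : RatFunc ℝ) • (1 : Matrix ι ι (RatFunc ℝ)) - A.map RatFunc.C
  -- Multiplied by `det M`, the determinant becomes that of `X • 1 - (A - B C)`, which is nonzero.
  refine isUnit_of_mul_isUnit_right (x := M.det) ?_
  rw [← Matrix.det_mul, Matrix.mul_add, Matrix.mul_one, Matrix.mul_assoc, ← Matrix.mul_assoc M,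
    Matrix.mul_nonsing_inv _ hM, Matrix.one_mul, ← Matrix.map_mul]
  rwa [Matrix.map_sub _ (map_sub _), sub_sub_eq_add_sub, add_sub_right_comm] at hN

/-- The invariant zeros of a system with direct feedthrough `1` are poles of its inverse. -/
theorem mem_eigenvalues_of_isInvariantZero_one [DecidableEq μ] {A : Matrix ι ι ℝ}
    {B : Matrix ι μ ℝ} {C : Matrix μ ι ℝ} {z : ℂ} (hz : IsInvariantZero A B C 1 z) :
    z ∈ eigenvalues (A - B * C) := by
  by_contra hcon
  refine absurd hz (not_lt.mpr ((Matrix.rank_le_card_height _).trans (ge_of_eq ?_)))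
  rw [rank_eq_card_iff_mulVec_surjective, systemMatrix_aeval]
  rw [mem_eigenvalues_iff_det] at hcon
  have hu := isUnit_iff_ne_zero.mpr hcon
  intro y
  set f := y ∘ Sum.inl
  set g := y ∘ Sum.inr
  set N := Matrix.scalar ι z - (A - B * C).map (algebraMap ℝ ℂ) with hN
  set x := N⁻¹ *ᵥ (f + B.map (algebraMap ℝ ℂ) *ᵥ g) with hx
  have h1 : N *ᵥ x = f + B.map (algebraMap ℝ ℂ) *ᵥ g := by
    rw [hx, Matrix.mulVec_mulVec, Matrix.mul_nonsing_inv _ hu, Matrix.one_mulVec]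
  -- With feedthrough one, the output row forces the input `g - C x`; substitution into the state
  -- row leaves `N x = f + B g`.
  refine ⟨Sum.elim x (g - C.map (algebraMap ℝ ℂ) *ᵥ x), ?_⟩
  rw [Matrix.fromBlocks_mulVec, Matrix.map_one _ (map_zero _) (map_one _)]
  simp only [Sum.elim_comp_inl, Sum.elim_comp_inr, Matrix.one_mulVec, add_sub_cancel]
  have h2 : (z • (1 : Matrix ι ι ℂ) - A.map (algebraMap ℝ ℂ)) *ᵥ x +
      (-B.map (algebraMap ℝ ℂ)) *ᵥ (g - C.map (algebraMap ℝ ℂ) *ᵥ x) = f := by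
    rw [hN, Matrix.map_sub _ (map_sub _), Matrix.map_mul, Matrix.scalar_apply,
      ← Matrix.smul_one_eq_diagonal, Matrix.sub_mulVec, Matrix.sub_mulVec,
      ← Matrix.mulVec_mulVec] at h1
    rw [Matrix.neg_mulVec, Matrix.mulVec_sub, Matrix.sub_mulVec, eq_comm,
      ← sub_eq_iff_eq_add.mpr h1]
    abel
  rw [h2]
  exact Sum.elim_comp_inl_inr y

end Rank

/-! ### Sylvester-type equations with an output constraint. -/

section Regulation

theorem exists_matrix_of_systemMatrix_surjective {ι μ π σ : Type} [Fintype ι] [Fintype μ]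
    [DecidableEq ι] {A : Matrix ι ι ℝ}
    {B : Matrix ι μ ℝ} {C : Matrix π ι ℝ} {z : ℂ}
    (h : Function.Surjective ((systemMatrix A B C 0).map (Polynomial.aeval z)).mulVec)
    (F : Matrix ι σ ℂ) (H : Matrix π σ ℂ) :
    ∃ (Z : Matrix ι σ ℂ) (Y : Matrix μ σ ℂ),
      z • Z - A.map (algebraMap ℝ ℂ) * Z - B.map (algebraMap ℝ ℂ) * Y = F ∧
        C.map (algebraMap ℝ ℂ) * Z = H := by
  choose v hv using fun j => h (Sum.elim (fun i => F i j) (fun i => H i j))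
  refine ⟨Matrix.of fun i j => v j (Sum.inl i), Matrix.of fun i j => v j (Sum.inr i), ?_, ?_⟩
  · ext i j
    have := congrFun (hv j) (Sum.inl i)
    rw [systemMatrix_aeval, Matrix.fromBlocks_mulVec] at this
    simp only [Sum.elim_inl, Matrix.sub_mulVec, Matrix.smul_mulVec, Matrix.one_mulVec,
      Matrix.neg_mulVec, ← sub_eq_add_neg] at this
    exact this
  · ext i j
    have := congrFun (hv j) (Sum.inr i)
    rw [systemMatrix_aeval, Matrix.fromBlocks_mulVec, Matrix.map_zero _ (map_zero _),
      Matrix.zero_mulVec, add_zero] at this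
    exact this

variable {ι μ π σ : Type} [Fintype ι] [Fintype μ] [Fintype σ] [DecidableEq σ]

/-- Solvability of the Sylvester-type equations modulo a polynomial in `S`. -/
theorem exists_sylvester_mod (A : Matrix ι ι ℂ) (B : Matrix ι μ ℂ) (C : Matrix π ι ℂ)
    (S : Matrix σ σ ℂ) (s : Multiset ℂ)
    (hs : ∀ z ∈ s, ∀ (F : Matrix ι σ ℂ) (H : Matrix π σ ℂ),
      ∃ (Z : Matrix ι σ ℂ) (Y : Matrix μ σ ℂ), z • Z - A * Z - B * Y = F ∧ C * Z = H)
    (F : Matrix ι σ ℂ) (H : Matrix π σ ℂ) :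
    ∃ (Z : Matrix ι σ ℂ) (Y : Matrix μ σ ℂ) (F' : Matrix ι σ ℂ) (H' : Matrix π σ ℂ),
      F = Z * S - A * Z - B * Y +
        F' * Polynomial.aeval S (s.map fun z => Polynomial.X - Polynomial.C z).prod ∧
      H = C * Z + H' * Polynomial.aeval S (s.map fun z => Polynomial.X - Polynomial.C z).prod := by
  induction s using Multiset.induction_on with
  | empty => exact ⟨0, 0, F, H, by simp, by simp⟩
  | cons l s ih =>
    obtain ⟨Z, Y, F', H', hF, hH⟩ := ih fun z hz => hs z (Multiset.mem_cons_of_mem hz)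
    obtain ⟨Z', Y', hF', hH'⟩ := hs l (Multiset.mem_cons_self l s) F' H'
    rw [Multiset.map_cons, Multiset.prod_cons, map_mul]
    set q : ℂ[X] := (s.map fun z => Polynomial.X - Polynomial.C z).prod
    have hcomm : Polynomial.aeval S q * S = S * Polynomial.aeval S q := by
      have : Polynomial.aeval S (q * Polynomial.X) = Polynomial.aeval S (Polynomial.X * q) := by
        rw [mul_comm]
      simpa using this
    -- Replacing `l Z'` by `Z' S` in the equation at `l` costs `Z' (S - l)`. So the new remainder is
    -- `-Z'` times the larger product, while `C Z' = H'` leaves none in the output equation.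
    refine ⟨Z + Z' * Polynomial.aeval S q, Y + Y' * Polynomial.aeval S q, -Z', 0, ?_, ?_⟩
    · rw [hF, ← hF', map_sub, Polynomial.aeval_X, Polynomial.aeval_C,
        Algebra.algebraMap_eq_smul_one]
      simp only [Matrix.add_mul, Matrix.mul_add, Matrix.sub_mul, Matrix.mul_sub, Matrix.neg_mul,
        Matrix.mul_assoc, hcomm, Matrix.smul_mul, Matrix.mul_smul, Matrix.one_mul, smul_neg]
      abel
    · rw [hH, ← hH', Matrix.mul_add, Matrix.zero_mul, add_zero, Matrix.mul_assoc]

theorem exists_sylvester (A : Matrix ι ι ℂ) (B : Matrix ι μ ℂ) (C : Matrix π ι ℂ)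
    (S : Matrix σ σ ℂ)
    (hs : ∀ z ∈ spectrum ℂ S, ∀ (F : Matrix ι σ ℂ) (H : Matrix π σ ℂ),
      ∃ (Z : Matrix ι σ ℂ) (Y : Matrix μ σ ℂ), z • Z - A * Z - B * Y = F ∧ C * Z = H)
    (F : Matrix ι σ ℂ) (H : Matrix π σ ℂ) :
    ∃ (Z : Matrix ι σ ℂ) (Y : Matrix μ σ ℂ), Z * S - A * Z - B * Y = F ∧ C * Z = H := by
  obtain ⟨Z, Y, F', H', hF, hH⟩ := exists_sylvester_mod A B C S S.charpoly.roots
    (fun z hz => hs z (Matrix.mem_spectrum_iff_isRoot_charpoly.mpr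
      (Polynomial.isRoot_of_mem_roots hz))) F H
  have hz : Polynomial.aeval S
      (S.charpoly.roots.map fun z => Polynomial.X - Polynomial.C z).prod = 0 := by
    rw [← (IsAlgClosed.splits S.charpoly).eq_prod_roots_of_monic S.charpoly_monic,
      Matrix.aeval_self_charpoly]
  rw [hz, Matrix.mul_zero, add_zero] at hF hH
  exact ⟨Z, Y, hF.symm, hH.symm⟩

theorem map_re_mul_map {α β γ : Type} [Fintype β] (M : Matrix α β ℝ) (Z : Matrix β γ ℂ) :
    (M.map (algebraMap ℝ ℂ) * Z).map Complex.re = M * Z.map Complex.re := by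
  ext i j
  simp [Matrix.mul_apply]

theorem map_re_map_mul {α β γ : Type} [Fintype β] (Z : Matrix α β ℂ) (M : Matrix β γ ℝ) :
    (Z * M.map (algebraMap ℝ ℂ)).map Complex.re = Z.map Complex.re * M := by
  ext i j
  simp [Matrix.mul_apply]

theorem map_re_map {α β : Type} (M : Matrix α β ℝ) :
    (M.map (algebraMap ℝ ℂ)).map Complex.re = M := by
  ext i j
  simp

end Regulation

/-! ### Regulation equations, pre-compensator, and the Hautus conditions of the cascade. -/

section Design

variable {n m p w : ℕ} {P : AgentModel n m p w}

theorem AgentModel.Assumptions.exists_regulation (hP : P.Assumptions) :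
    ∃ (Pi : Matrix (Fin n) (Fin w) ℝ) (Gam : Matrix (Fin m) (Fin w) ℝ),
      RegulationEquations P Pi Gam := by
  obtain ⟨Z, Y, hZ, hC⟩ := exists_sylvester (P.A.map (algebraMap ℝ ℂ)) (P.B.map (algebraMap ℝ ℂ))
    (P.C.map (algebraMap ℝ ℂ)) (P.S.map (algebraMap ℝ ℂ))
    (fun z hz => exists_matrix_of_systemMatrix_surjective
      (systemMatrix_mulVec_surjective hP.right_invertible fun h => hP.zeros_disjoint z h hz))
    (P.E.map (algebraMap ℝ ℂ)) (-P.G.map (algebraMap ℝ ℂ))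
  -- All coefficients are real, so the real part of a complex solution is a solution.
  refine ⟨Z.map Complex.re, Y.map Complex.re, ?_, ?_⟩
  · have h := congrArg (fun M => Matrix.map M Complex.re) hZ
    simp only [Matrix.map_sub _ Complex.sub_re, map_re_map_mul, map_re_mul_map, map_re_map] at h
    rw [← h]; abel
  · have h := congrArg (fun M => Matrix.map M Complex.re) hC
    simp only [map_re_mul_map, Matrix.map_neg _ Complex.neg_re, map_re_map] at h
    rw [h, neg_add_cancel]

/-- The regulation equations over the complex numbers, applied to a vector. -/
theorem RegulationEquations.mulVec {Pi : Matrix (Fin n) (Fin w) ℝ} {Gam : Matrix (Fin m) (Fin w) ℝ}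
    (h : RegulationEquations P Pi Gam) (v : Fin w → ℂ) :
    Pi.map (algebraMap ℝ ℂ) *ᵥ (P.S.map (algebraMap ℝ ℂ) *ᵥ v) =
        P.A.map (algebraMap ℝ ℂ) *ᵥ (Pi.map (algebraMap ℝ ℂ) *ᵥ v) +
        P.B.map (algebraMap ℝ ℂ) *ᵥ (Gam.map (algebraMap ℝ ℂ) *ᵥ v) +
        P.E.map (algebraMap ℝ ℂ) *ᵥ v ∧
      P.C.map (algebraMap ℝ ℂ) *ᵥ (Pi.map (algebraMap ℝ ℂ) *ᵥ v) +
        P.G.map (algebraMap ℝ ℂ) *ᵥ v = 0 := by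
  obtain ⟨h1, h2⟩ := h
  have h1' := congrArg (fun M => Matrix.map M (algebraMap ℝ ℂ) *ᵥ v) h1
  have h2' := congrArg (fun M => Matrix.map M (algebraMap ℝ ℂ) *ᵥ v) h2
  simp only [Matrix.map_add _ (map_add _), Matrix.map_mul, Matrix.add_mulVec,
    Matrix.map_zero _ (map_zero _), Matrix.zero_mulVec, ← Matrix.mulVec_mulVec] at h1' h2'
  exact ⟨h1', h2'⟩

/-- The Hautus form of the detectability assumption. -/
theorem AgentModel.Assumptions.eq_zero_of_undetected (hP : P.Assumptions) {z : ℂ} (hz : 1 ≤ ‖z‖)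
    {x : Fin n → ℂ} {v : Fin w → ℂ}
    (hx : P.A.map (algebraMap ℝ ℂ) *ᵥ x + P.E.map (algebraMap ℝ ℂ) *ᵥ v = z • x)
    (hv : P.S.map (algebraMap ℝ ℂ) *ᵥ v = z • v)
    (hy : P.C.map (algebraMap ℝ ℂ) *ᵥ x + P.G.map (algebraMap ℝ ℂ) *ᵥ v = 0) :
    x = 0 ∧ v = 0 := by
  have h := hP.detectable.hautus hz (v := Sum.elim x (-v)) ?_ ?_
  · refine ⟨funext fun i => congrFun h (Sum.inl i), funext fun i => ?_⟩
    simpa using congrFun h (Sum.inr i)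
  · rw [Matrix.fromBlocks_map, Matrix.fromBlocks_mulVec, Matrix.map_neg _ (map_neg _),
      Matrix.map_zero _ (map_zero _)]
    simp only [Sum.elim_comp_inl, Sum.elim_comp_inr, Matrix.neg_mulVec, Matrix.mulVec_neg, neg_neg,
      Matrix.zero_mulVec, zero_add, hx, hv]
    ext (i | i) <;> simp
  · rw [show (Matrix.fromCols P.C (-P.G)).map (algebraMap ℝ ℂ) = Matrix.fromCols
      (P.C.map (algebraMap ℝ ℂ)) (-P.G.map (algebraMap ℝ ℂ)) by ext i (j | j) <;> simp,
      Matrix.fromCols_mulVec]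
    simpa only [Sum.elim_comp_inl, Sum.elim_comp_inr, Matrix.neg_mulVec, Matrix.mulVec_neg, neg_neg]
      using hy

/-- If `S v = z v` and `Γ v = 0` with `|z| ≥ 1`, then `(Π v, v)` is an undetected mode of agent and
exosystem, hence zero. So `(Γ, S)` is detectable. With `D_p = 1` the zeros of the pre-compensator
are eigenvalues of `S - B_p Γ`, and `B_p` is taken as a stabilizing output injection. -/
theorem AgentModel.Assumptions.exists_precompensator (hP : P.Assumptions)
    {Pi : Matrix (Fin n) (Fin w) ℝ} {Gam : Matrix (Fin m) (Fin w) ℝ}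
    (h : RegulationEquations P Pi Gam) :
    ∃ (Bp : Matrix (Fin w) (Fin m) ℝ) (Dp : Matrix (Fin m) (Fin m) ℝ),
      AdmissiblePrecompensator P Gam Bp Dp := by
  have hdet : Detectable Gam P.S := by
    refine detectable_of_hautus fun z hz v hv hG => ?_
    obtain ⟨h1, h2⟩ := h.mulVec v
    rw [hv, hG, Matrix.mulVec_zero, add_zero, Matrix.mulVec_smul] at h1
    exact (hP.eq_zero_of_undetected hz h1.symm hv h2).2
  obtain ⟨Bp, hBp⟩ := hdet
  exact ⟨Bp, 1, invertibleSystem_one _ _ _,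
    fun z hz => hBp z (mem_eigenvalues_of_isInvariantZero_one hz)⟩

theorem AdmissiblePrecompensator.stabilizable_cascade {Gam : Matrix (Fin m) (Fin w) ℝ}
    {Bp : Matrix (Fin w) (Fin m) ℝ} {Dp : Matrix (Fin m) (Fin m) ℝ}
    (h : AdmissiblePrecompensator P Gam Bp Dp) (hP : Stabilizable P.A P.B) :
    Stabilizable (cascadeA P Gam) (cascadeB P Bp Dp) := by
  refine HautusCondition.stabilizable fun z hz ab hab hB => ?_
  obtain ⟨a, b, rfl⟩ : ∃ a b, ab = Sum.elim a b := ⟨_, _, (Sum.elim_comp_inl_inr ab).symm⟩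
  rw [cascadeA, Matrix.fromBlocks_map, Matrix.vecMul_fromBlocks, Matrix.map_mul,
    Matrix.map_zero _ (map_zero _), ← Matrix.vecMul_vecMul] at hab
  rw [cascadeB, show (Matrix.fromRows (P.B * Dp) Bp).map (algebraMap ℝ ℂ) = Matrix.fromRows
      ((P.B * Dp).map (algebraMap ℝ ℂ)) (Bp.map (algebraMap ℝ ℂ)) by ext (i | i) j <;> simp,
    Matrix.vecMul_fromRows, Matrix.map_mul, ← Matrix.vecMul_vecMul] at hB
  simp only [Sum.elim_comp_inl, Sum.elim_comp_inr, Matrix.vecMul_zero, add_zero] at hab hB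
  have ha : a ᵥ* P.A.map (algebraMap ℝ ℂ) = z • a := funext fun i => congrFun hab (Sum.inl i)
  have hb : a ᵥ* P.B.map (algebraMap ℝ ℂ) ᵥ* Gam.map (algebraMap ℝ ℂ) +
      b ᵥ* P.S.map (algebraMap ℝ ℂ) = z • b := funext fun i => congrFun hab (Sum.inr i)
  -- The eigenvector equation and `hB` say that `(b, -a B)` is a left null vector of the
  -- pre-compensator's Rosenbrock matrix, which has full row rank at `z` by minimum phase. It
  -- remains to apply stabilizability of `(A, B)` to `a`.
  have hzero := eq_zero_of_vecMul_eq_zero (systemMatrix_mulVec_surjective h.1.rightInvertible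
    fun h0 => absurd (h.2 z h0) (not_lt.mpr hz))
    (a := Sum.elim b (-(a ᵥ* P.B.map (algebraMap ℝ ℂ)))) (by
      rw [systemMatrix_aeval, Matrix.vecMul_fromBlocks]
      simp only [Sum.elim_comp_inl, Sum.elim_comp_inr, Matrix.vecMul_sub, Matrix.vecMul_smul,
        Matrix.vecMul_one, Matrix.neg_vecMul, Matrix.vecMul_neg, ← hb]
      rw [show -(b ᵥ* Bp.map (algebraMap ℝ ℂ)) +
        -(a ᵥ* P.B.map (algebraMap ℝ ℂ) ᵥ* Dp.map (algebraMap ℝ ℂ)) = 0 by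
          rw [← neg_add, add_comm, hB, neg_zero]]
      ext (i | i) <;> simp)
  have hb0 : b = 0 := funext fun i => congrFun hzero (Sum.inl i)
  have haB : a ᵥ* P.B.map (algebraMap ℝ ℂ) = 0 :=
    neg_eq_zero.mp (funext fun i => congrFun hzero (Sum.inr i))
  rw [hP.hautus z hz a ha haB, hb0]
  ext (i | i) <;> rfl

theorem AgentModel.Assumptions.detectable_cascade (hP : P.Assumptions)
    {Pi : Matrix (Fin n) (Fin w) ℝ} {Gam : Matrix (Fin m) (Fin w) ℝ}
    (h : RegulationEquations P Pi Gam) : Detectable (cascadeC P) (cascadeA P Gam) := by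
  refine detectable_of_hautus fun z hz xv hxv hC => ?_
  obtain ⟨x, v, rfl⟩ : ∃ a b, xv = Sum.elim a b := ⟨_, _, (Sum.elim_comp_inl_inr xv).symm⟩
  rw [cascadeA, Matrix.fromBlocks_map, Matrix.fromBlocks_mulVec, Matrix.map_mul,
    Matrix.map_zero _ (map_zero _), ← Matrix.mulVec_mulVec] at hxv
  rw [cascadeC, show (Matrix.fromCols P.C (0 : Matrix (Fin p) (Fin w) ℝ)).map (algebraMap ℝ ℂ) =
      Matrix.fromCols (P.C.map (algebraMap ℝ ℂ)) 0 by ext i (j | j) <;> simp,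
    Matrix.fromCols_mulVec] at hC
  simp only [Sum.elim_comp_inl, Sum.elim_comp_inr, Matrix.zero_mulVec, add_zero, zero_add]
    at hxv hC
  have hx : P.A.map (algebraMap ℝ ℂ) *ᵥ x +
      P.B.map (algebraMap ℝ ℂ) *ᵥ (Gam.map (algebraMap ℝ ℂ) *ᵥ v) = z • x :=
    funext fun i => congrFun hxv (Sum.inl i)
  have hv : P.S.map (algebraMap ℝ ℂ) *ᵥ v = z • v := funext fun i => congrFun hxv (Sum.inr i)
  obtain ⟨h1, h2⟩ := h.mulVec v
  rw [hv, Matrix.mulVec_smul] at h1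
  -- Subtracting the regulated trajectory turns an undetected mode of the cascade into one of agent
  -- and exosystem.
  obtain ⟨hxz, hvz⟩ := hP.eq_zero_of_undetected hz
    (x := Pi.map (algebraMap ℝ ℂ) *ᵥ v - x) (v := v)
    (by rw [smul_sub, h1, ← hx, Matrix.mulVec_sub]; abel) hv
    (by rw [Matrix.mulVec_sub, hC, sub_zero, h2])
  rw [hvz, Matrix.mulVec_zero, zero_sub, neg_eq_zero] at hxz
  rw [hxz, hvz]
  ext (i | i) <;> rfl

end Design

/-! ### Growth of matrix powers and stability of driven linear recursions. -/

section Decay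

attribute [local instance] Matrix.linftyOpNormedRing Matrix.linftyOpNormedAlgebra

/-- The powers of a matrix grow at most like `r ^ k` if its eigenvalues have modulus below `r`. -/
theorem exists_norm_pow_mulVec_le {ι : Type} [Fintype ι] [DecidableEq ι] (M : Matrix ι ι ℝ) {r : ℝ}
    (hr : 0 < r) (h : ∀ z ∈ eigenvalues M, ‖z‖ < r) :
    ∃ c, 0 ≤ c ∧ ∀ (k : ℕ) (v : ι → ℝ), ‖(M ^ k) *ᵥ v‖ ≤ c * r ^ k * ‖v‖ := by
  cases isEmpty_or_nonempty ι with
  | inl _ =>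
    refine ⟨0, le_rfl, fun k v => ?_⟩
    rw [Subsingleton.elim ((M ^ k) *ᵥ v) 0]
    simp
  | inr _ =>
    set a : Matrix ι ι ℂ := M.map (algebraMap ℝ ℂ) with ha
    lift r to NNReal using hr.le
    have hlt : spectralRadius ℂ a < r :=
      spectrum.spectralRadius_lt_of_forall_lt a fun z hz => h z hz
    have hev := (spectrum.pow_nnnorm_pow_one_div_tendsto_nhds_spectralRadius a).eventually_lt_const
      hlt
    obtain ⟨k₀, hk₀⟩ := eventually_atTop.mp hev
    have hbig : ∀ k, k₀ + 1 ≤ k → ‖a ^ k‖ ≤ (r : ℝ) ^ k := by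
      intro k hk
      have hk1 := (hk₀ k (by omega)).le
      have hk0 : (0 : ℝ) < k := by exact_mod_cast (show 0 < k by omega)
      rw [one_div, ENNReal.rpow_inv_le_iff hk0, ENNReal.rpow_natCast] at hk1
      exact_mod_cast hk1
    -- Gelfand's formula gives the bound `r ^ k` for large `k`; the sum absorbs the finitely many
    -- remaining powers.
    set c : ℝ := 1 + ∑ j ∈ Finset.range (k₀ + 1), ‖a ^ j‖ / (r : ℝ) ^ j with hc
    have hsum : ∀ s : Finset ℕ, 0 ≤ ∑ j ∈ s, ‖a ^ j‖ / (r : ℝ) ^ j := fun s =>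
      Finset.sum_nonneg fun j _ => by positivity
    have hpow : ∀ k, ‖a ^ k‖ ≤ c * (r : ℝ) ^ k := by
      intro k
      by_cases hk : k₀ + 1 ≤ k
      · refine (hbig k hk).trans (le_mul_of_one_le_left (by positivity) ?_)
        linarith [hsum (Finset.range (k₀ + 1))]
      · rw [← div_le_iff₀ (by positivity)]
        have := Finset.single_le_sum (f := fun j => ‖a ^ j‖ / (r : ℝ) ^ j)
          (fun j _ => by positivity) (Finset.mem_range.mpr (not_le.mp hk))
        linarith
    refine ⟨c, by linarith [hsum (Finset.range (k₀ + 1))], fun k v => ?_⟩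
    have hnorm : ∀ x : ι → ℝ, ‖(fun i => (x i : ℂ))‖ = ‖x‖ := fun x => by
      simp [Pi.norm_def, Complex.nnnorm_real]
    have hmap : (fun i => (((M ^ k) *ᵥ v) i : ℂ)) = (a ^ k) *ᵥ fun i => (v i : ℂ) := by
      rw [ha, ← RingHom.mapMatrix_apply, ← map_pow]
      ext i
      simp [Matrix.mulVec, dotProduct]
    rw [← hnorm, hmap, ← hnorm v]
    exact (Matrix.linfty_opNorm_mulVec _ _).trans
      (mul_le_mul_of_nonneg_right (hpow k) (norm_nonneg _))

theorem tendsto_zero_of_affine_recursion {ρ : ℝ} (h0 : 0 ≤ ρ) (h1 : ρ < 1) {a b : ℕ → ℝ}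
    (hb : Tendsto b atTop (𝓝 0)) (ha : ∀ k, a (k + 1) = ρ * a k + b k) :
    Tendsto a atTop (𝓝 0) := by
  rw [Metric.tendsto_atTop]
  intro ε hε
  obtain ⟨k₀, hk₀⟩ := Metric.tendsto_atTop.mp hb (ε / 2 * (1 - ρ)) (by nlinarith)
  have hbound : ∀ j, |a (k₀ + j)| ≤ ε / 2 + ρ ^ j * |a k₀| := by
    intro j
    induction j with
    | zero => simp; linarith
    | succ j ih =>
      have hbj := hk₀ (k₀ + j) (by omega)
      rw [Real.dist_eq, sub_zero] at hbj
      rw [← add_assoc, ha, pow_succ']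
      calc |ρ * a (k₀ + j) + b (k₀ + j)| ≤ ρ * |a (k₀ + j)| + |b (k₀ + j)| := by
            refine (abs_add_le _ _).trans ?_
            rw [abs_mul, abs_of_nonneg h0]
        _ ≤ ρ * (ε / 2 + ρ ^ j * |a k₀|) + ε / 2 * (1 - ρ) := by
            have := mul_le_mul_of_nonneg_left ih h0
            linarith
        _ = ε / 2 + ρ * ρ ^ j * |a k₀| := by ring
  have hgeo : Tendsto (fun j => ρ ^ j * |a k₀|) atTop (𝓝 0) := by
    simpa using (tendsto_pow_atTop_nhds_zero_of_lt_one h0 h1).mul_const |a k₀|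
  obtain ⟨j₀, hj₀⟩ := Metric.tendsto_atTop.mp hgeo (ε / 2) (by linarith)
  refine ⟨k₀ + j₀, fun k hk => ?_⟩
  obtain ⟨j, rfl⟩ := Nat.exists_eq_add_of_le (show k₀ ≤ k by omega)
  have hj := hj₀ j (by omega)
  rw [Real.dist_eq, sub_zero] at hj ⊢
  linarith [hbound j, le_abs_self (ρ ^ j * |a k₀|)]

/-- A geometrically contracting linear recursion maps vanishing inputs to vanishing states. -/
theorem tendsto_zero_of_linear_recursion {V : Type*} [AddCommGroup V] [Module ℝ V]
    (q : Seminorm ℝ V) (T : Module.End ℝ V) {c ρ : ℝ} (h0 : 0 ≤ ρ) (h1 : ρ < 1)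
    (hT : ∀ (k : ℕ) (v : V), q ((T ^ k) v) ≤ c * ρ ^ k * q v) {v u : ℕ → V}
    (hv : ∀ k, v (k + 1) = T (v k) + u k) (hu : Tendsto (fun k => q (u k)) atTop (𝓝 0)) :
    Tendsto (fun k => q (v k)) atTop (𝓝 0) := by
  -- A scalar majorant. The bound is proved for every `T ^ j (v k)` at once, so that the induction
  -- on `k` closes although a single application of `T` need not contract.
  let a : ℕ → ℝ := fun k => Nat.rec (c * q (v 0)) (fun k x => ρ * x + c * q (u k)) k
  have ha : Tendsto a atTop (𝓝 0) :=
    tendsto_zero_of_affine_recursion h0 h1 (by simpa using hu.const_mul c) fun k => rfl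
  have key : ∀ k j, q ((T ^ j) (v k)) ≤ ρ ^ j * a k := by
    intro k
    induction k with
    | zero => intro j; exact (hT j _).trans (le_of_eq (by change _ = _ * (c * q (v 0)); ring))
    | succ k ih =>
      intro j
      change _ ≤ ρ ^ j * (ρ * a k + c * q (u k))
      rw [hv, map_add, ← Module.End.mul_apply, ← pow_succ]
      refine (map_add_le_add q _ _).trans ?_
      exact (add_le_add (ih (j + 1)) (hT j (u k))).trans (le_of_eq (by ring))
  exact squeeze_zero (fun k => apply_nonneg q _) (fun k => by simpa using key k 0) ha

theorem IsSchur.tendsto_zero {ι : Type} [Fintype ι] [DecidableEq ι] {M : Matrix ι ι ℝ}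
    (hM : IsSchur M) {v u : ℕ → ι → ℝ} (hv : ∀ k, v (k + 1) = M *ᵥ v k + u k)
    (hu : Tendsto u atTop (𝓝 0)) : Tendsto v atTop (𝓝 0) := by
  obtain ⟨ρ, h0, h1, hρ⟩ : ∃ ρ : ℝ, 0 < ρ ∧ ρ < 1 ∧ ∀ z ∈ eigenvalues M, ‖z‖ < ρ := by
    have hfin : (eigenvalues M).Finite :=
      (Polynomial.finite_setOfPred_isRoot
        (M.map (algebraMap ℝ ℂ)).charpoly_monic.ne_zero).subset
          fun z hz => mem_eigenvalues_iff_isRoot.mp hz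
    -- Inserting `0` gives a maximum even when the index type, hence the spectrum, is empty.
    have hs : (insert 0 (norm '' eigenvalues M)).Finite := (hfin.image _).insert _
    obtain ⟨m, hm, hmax⟩ := Set.exists_max_image _ id hs ⟨0, Set.mem_insert _ _⟩
    have hm0 : 0 ≤ m := hmax 0 (Set.mem_insert _ _)
    have hm1 : m < 1 := by
      rcases hm with rfl | ⟨z, hz, rfl⟩
      · exact one_pos
      · exact hM z hz
    refine ⟨(m + 1) / 2, by linarith, by linarith, fun z hz => ?_⟩
    have : ‖z‖ ≤ m := hmax _ (Set.mem_insert_of_mem _ ⟨z, hz, rfl⟩)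
    linarith
  obtain ⟨c, -, hc⟩ := exists_norm_pow_mulVec_le M h0 hρ
  have := tendsto_zero_of_linear_recursion (normSeminorm ℝ (ι → ℝ)) (Matrix.toLin' M) h0.le h1
    (fun k x => by rw [← Matrix.toLin'_pow, Matrix.toLin'_apply]; exact hc k x)
    (v := v) (u := u) (fun k => by rw [Matrix.toLin'_apply, hv])
    (tendsto_zero_iff_norm_tendsto_zero.mp hu)
  exact tendsto_zero_iff_norm_tendsto_zero.mpr this

theorem tendsto_mulVec_zero {ι ι' : Type} [Fintype ι] (M : Matrix ι' ι ℝ) {v : ℕ → ι → ℝ}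
    (hv : Tendsto v atTop (𝓝 0)) : Tendsto (fun k => M *ᵥ v k) atTop (𝓝 0) := by
  have : Continuous fun v : ι → ℝ => M *ᵥ v := by fun_prop
  simpa [Function.comp_def] using (this.tendsto 0).comp hv

end Decay

/-! ### Contraction of differences by stochastic matrices. -/

section Consensus

variable {α : Type} [Fintype α] {E : Type} [NormedAddCommGroup E] [NormedSpace ℝ E]

/-- The largest distance between two entries of a vector. -/
noncomputable def spread (α E : Type) [Fintype α] [NormedAddCommGroup E] [NormedSpace ℝ E] :
    Seminorm ℝ (α → E) :=
  (normSeminorm ℝ (α × α → E)).comp <| show (α → E) →ₗ[ℝ] (α × α → E) from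
    { toFun := fun v ij => v ij.1 - v ij.2
      map_add' := fun v v' => by ext ij; simp [add_sub_add_comm]
      map_smul' := fun t v => by ext ij; simp [smul_sub] }

theorem norm_sub_le_spread (v : α → E) (i j : α) : ‖v i - v j‖ ≤ spread α E v :=
  norm_le_pi_norm (fun ij : α × α => v ij.1 - v ij.2) (i, j)

theorem spread_le {v : α → E} {b : ℝ} (hb : 0 ≤ b) (h : ∀ i j, ‖v i - v j‖ ≤ b) :
    spread α E v ≤ b :=
  (pi_norm_le_iff_of_nonneg hb).mpr fun ij => h ij.1 ij.2

/-- The averages of a vector with the rows of a matrix as weights. -/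
def mix {F : Type} [AddCommGroup F] [Module ℝ F] (D : Matrix α α ℝ) (v : α → F) : α → F :=
  fun i => ∑ l, D i l • v l

theorem mix_mul (D D' : Matrix α α ℝ) (v : α → E) : mix (D * D') v = mix D (mix D' v) := by
  ext i
  simp only [mix, Matrix.mul_apply, Finset.sum_smul, Finset.smul_sum, mul_smul]
  exact Finset.sum_comm

/-- Couple the two weightings by the product weights `a l * b l'`: `c` times the difference is a sum
of `v l - v l'` of total weight `c²`. -/
theorem norm_sum_sub_sum_le {a b : α → ℝ} {c : ℝ} (ha : ∀ l, 0 ≤ a l) (hb : ∀ l, 0 ≤ b l)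
    (hac : ∑ l, a l = c) (hbc : ∑ l, b l = c) (v : α → E) :
    ‖∑ l, a l • v l - ∑ l, b l • v l‖ ≤ c * spread α E v := by
  have hc : 0 ≤ c := hac ▸ Finset.sum_nonneg fun l _ => ha l
  rcases hc.eq_or_lt with rfl | hc
  · have ha' : ∀ l, a l = 0 := fun l =>
      (Finset.sum_eq_zero_iff_of_nonneg fun l _ => ha l).mp hac l (Finset.mem_univ l)
    have hb' : ∀ l, b l = 0 := fun l =>
      (Finset.sum_eq_zero_iff_of_nonneg fun l _ => hb l).mp hbc l (Finset.mem_univ l)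
    simp [ha', hb']
  · have h : c • (∑ l, a l • v l - ∑ l, b l • v l) =
        ∑ l, ∑ l', (a l * b l') • (v l - v l') := by
      simp only [smul_sub, Finset.sum_sub_distrib]
      congr 1
      · rw [Finset.smul_sum]
        refine Finset.sum_congr rfl fun l _ => ?_
        rw [← Finset.sum_smul, ← Finset.mul_sum, hbc, smul_smul, mul_comm]
      · rw [Finset.sum_comm, Finset.smul_sum]
        refine Finset.sum_congr rfl fun l _ => ?_
        rw [← Finset.sum_smul, ← Finset.sum_mul, hac, smul_smul]
    have h2 : ‖c • (∑ l, a l • v l - ∑ l, b l • v l)‖ ≤ c * (c * spread α E v) := by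
      rw [h]
      calc _ ≤ ∑ l, ∑ l', a l * b l' * spread α E v := by
            refine norm_sum_le_of_le _ fun l _ => norm_sum_le_of_le _ fun l' _ => ?_
            rw [norm_smul, Real.norm_of_nonneg (mul_nonneg (ha l) (hb l'))]
            exact mul_le_mul_of_nonneg_left (norm_sub_le_spread v l l')
              (mul_nonneg (ha l) (hb l'))
        _ = c * (c * spread α E v) := by
            simp only [← Finset.sum_mul, ← Finset.mul_sum, hac, hbc]
            ring
    rw [norm_smul, Real.norm_of_nonneg hc.le] at h2
    exact le_of_mul_le_mul_left h2 hc

/-- A row stochastic matrix with a positive column contracts the spread. -/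
theorem spread_mix_le [DecidableEq α] {D : Matrix α α ℝ} (hD : D ∈ Matrix.rowStochastic ℝ α)
    {r : α} {ε : ℝ} (hε : ∀ i, ε ≤ D i r) (v : α → E) :
    spread α E (mix D v) ≤ (1 - ε) * spread α E v := by
  have h1 : ε ≤ 1 := (hε r).trans (Matrix.le_one_of_mem_rowStochastic hD)
  refine spread_le (mul_nonneg (by linarith) (apply_nonneg _ _)) fun i j => ?_
  -- Removing the common weight `ε` at `r` from both rows does not change their difference and
  -- leaves weights of total `1 - ε`.
  have hnn : ∀ i l, 0 ≤ D i l - if l = r then ε else 0 := by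
    intro i l
    split_ifs with h
    · rw [h]; linarith [hε i]
    · linarith [Matrix.nonneg_of_mem_rowStochastic hD (i := i) (j := l)]
  have hsum : ∀ i, ∑ l, (D i l - if l = r then ε else 0) = 1 - ε := by
    intro i
    rw [Finset.sum_sub_distrib, Matrix.sum_row_of_mem_rowStochastic hD]
    simp
  have := norm_sum_sub_sum_le (hnn i) (hnn j) (hsum i) (hsum j) v
  simpa only [mix, sub_smul, Finset.sum_sub_distrib, sub_sub_sub_cancel_right] using this

/-- The powers of a row stochastic matrix contract the spread geometrically if one of them has a
positive column. -/
theorem exists_spread_mix_pow_le [DecidableEq α] {D : Matrix α α ℝ}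
    (hD : D ∈ Matrix.rowStochastic ℝ α) {r : α} {k₀ : ℕ} (hk₀ : ∀ i, 0 < (D ^ k₀) i r) :
    ∃ c ρ : ℝ, 0 ≤ c ∧ 0 < ρ ∧ ρ < 1 ∧ ∀ (k : ℕ) (v : α → E),
      spread α E (mix (D ^ k) v) ≤ c * ρ ^ k * spread α E v := by
  have hnonexp : ∀ (k : ℕ) (v : α → E), spread α E (mix (D ^ k) v) ≤ spread α E v := fun k v => by
    simpa using spread_mix_le (pow_mem hD k) (r := r) (ε := 0)
      (fun i => Matrix.nonneg_of_mem_rowStochastic (pow_mem hD k)) v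
  rcases Nat.eq_zero_or_pos k₀ with rfl | hpos
  -- A positive column in the identity matrix means that `r` is the only index, so every spread is
  -- zero.
  · refine ⟨0, 1 / 2, le_rfl, by norm_num, by norm_num, fun k v => ?_⟩
    have hr : ∀ i, i = r := fun i => by
      by_contra h
      simpa [Matrix.one_apply, h] using hk₀ i
    refine spread_le (by simp) fun i j => ?_
    rw [hr i, hr j]
    simp
  · obtain ⟨i₀, -, hmin⟩ := Finset.exists_min_image Finset.univ (fun i => (D ^ k₀) i r)
      ⟨r, Finset.mem_univ r⟩
    -- The maximum with `1 / 2` keeps `c` positive, so that its inverse and its `k₀`-th root can be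
    -- used.
    set c : ℝ := max (1 - (D ^ k₀) i₀ r) (1 / 2) with hc
    have hc0 : 0 < c := lt_max_of_lt_right (by norm_num)
    have hc1 : c < 1 := max_lt (by linarith [hk₀ i₀]) (by norm_num)
    have hstep : ∀ v : α → E, spread α E (mix (D ^ k₀) v) ≤ c * spread α E v := fun v =>
      (spread_mix_le (pow_mem hD k₀) (fun i => hmin i (Finset.mem_univ i)) v).trans
        (mul_le_mul_of_nonneg_right (le_max_left _ _) (apply_nonneg _ _))
    have hiter : ∀ (a : ℕ) (v : α → E),
        spread α E (mix (D ^ (k₀ * a)) v) ≤ c ^ a * spread α E v := by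
      intro a
      induction a with
      | zero => intro v; simpa using hnonexp 0 v
      | succ a ih =>
        intro v
        rw [Nat.mul_succ, pow_add, mix_mul, pow_succ, mul_assoc]
        exact (ih _).trans (mul_le_mul_of_nonneg_left (hstep v) (by positivity))
    set ρ : ℝ := c ^ ((k₀ : ℝ)⁻¹) with hρ
    have hρ0 : 0 < ρ := Real.rpow_pos_of_pos hc0 _
    have hρ1 : ρ < 1 := Real.rpow_lt_one hc0.le hc1 (by positivity)
    have hρk : ρ ^ k₀ = c := Real.rpow_inv_natCast_pow hc0.le hpos.ne'
    refine ⟨c⁻¹, ρ, by positivity, hρ0, hρ1, fun k v => ?_⟩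
    -- Only complete blocks of length `k₀` contract; the incomplete last block costs the factor
    -- `c⁻¹`.
    have hle : c ^ (k / k₀) ≤ c⁻¹ * ρ ^ k := by
      conv_rhs => rw [← Nat.div_add_mod k k₀, pow_add, pow_mul, hρk]
      have : c ≤ ρ ^ (k % k₀) := by
        rw [← hρk]
        exact pow_le_pow_of_le_one hρ0.le hρ1.le (Nat.mod_lt _ hpos).le
      rw [mul_left_comm]
      refine le_mul_of_one_le_right (by positivity) ?_
      rwa [inv_mul_eq_div, one_le_div hc0]
    conv_lhs => rw [← Nat.div_add_mod k k₀, pow_add, mix_mul]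
    calc _ ≤ c ^ (k / k₀) * spread α E (mix (D ^ (k % k₀)) v) := hiter _ _
      _ ≤ c ^ (k / k₀) * spread α E v := mul_le_mul_of_nonneg_left (hnonexp _ _) (by positivity)
      _ ≤ _ := mul_le_mul_of_nonneg_right hle (apply_nonneg _ _)

end Consensus

/-! ### The averaging matrix of the graph and consensus of coupled systems. -/

section Graph

variable {N : ℕ} (g : WeightedDigraph N) (dbar : Fin N → ℝ)

/-- The matrix `1 - L` for the weighted Laplacian `L` of the localized information. -/
noncomputable def averagingMatrix : Matrix (Fin N) (Fin N) ℝ :=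
  Matrix.of fun i j => g.weight i j / (1 + dbar i) +
    if i = j then 1 - ∑ l, g.weight i l / (1 + dbar i) else 0

theorem sub_localInfo {ν : Type} (v : Fin N → ν → ℝ) :
    v - localInfo g dbar v = mix (averagingMatrix g dbar) v := by
  ext1 i
  simp only [Pi.sub_apply, localInfo, mix, averagingMatrix, Matrix.of_apply, add_smul,
    Finset.sum_add_distrib, ite_smul, zero_smul, Finset.sum_ite_eq, Finset.mem_univ, if_true,
    smul_sub, Finset.sum_sub_distrib, sub_smul, one_smul, Finset.sum_smul]
  abel

variable {g dbar}

/-- The `1` in the denominator makes the inequality strict, which gives the averaging matrix a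
positive diagonal. -/
theorem WeightedDigraph.sum_weight_div_lt_one (hd : ∀ i, g.inDegree i ≤ dbar i) (i : Fin N) :
    0 < 1 + dbar i ∧ ∑ l, g.weight i l / (1 + dbar i) < 1 := by
  have h0 : 0 ≤ g.inDegree i := Finset.sum_nonneg fun l _ => g.nonneg i l
  have h1 : 0 < 1 + dbar i := by linarith [hd i]
  refine ⟨h1, ?_⟩
  rw [← Finset.sum_div, div_lt_one h1]
  exact (hd i).trans_lt (by linarith)

theorem averagingMatrix_mem_rowStochastic (hd : ∀ i, g.inDegree i ≤ dbar i) :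
    averagingMatrix g dbar ∈ Matrix.rowStochastic ℝ (Fin N) := by
  rw [Matrix.mem_rowStochastic_iff_sum]
  refine ⟨fun i j => ?_, fun i => ?_⟩
  · obtain ⟨h1, h2⟩ := g.sum_weight_div_lt_one hd i
    refine add_nonneg (div_nonneg (g.nonneg i j) h1.le) ?_
    split_ifs <;> linarith
  · simp [averagingMatrix, Finset.sum_add_distrib]

theorem averagingMatrix_diag_pos (hd : ∀ i, g.inDegree i ≤ dbar i) (i : Fin N) :
    0 < averagingMatrix g dbar i i := by
  obtain ⟨h1, h2⟩ := g.sum_weight_div_lt_one hd i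
  simp only [averagingMatrix, Matrix.of_apply, g.loopless, if_true]
  linarith [zero_div (1 + dbar i)]

theorem averagingMatrix_pos (hd : ∀ i, g.inDegree i ≤ dbar i) {i j : Fin N}
    (h : 0 < g.weight i j) : 0 < averagingMatrix g dbar i j := by
  obtain ⟨h1, h2⟩ := g.sum_weight_div_lt_one hd i
  refine add_pos_of_pos_of_nonneg (div_pos h h1) ?_
  split_ifs <;> linarith

/-- A path of length `k` from the root to `i` makes entry `(i, r)` of the `k`-th power positive. The
positive diagonal preserves this for higher powers, so one exponent serves all nodes. -/
theorem exists_averagingMatrix_pow_pos (hg : g.HasDirectedSpanningTree)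
    (hd : ∀ i, g.inDegree i ≤ dbar i) :
    ∃ (r : Fin N) (k : ℕ), ∀ i, 0 < (averagingMatrix g dbar ^ k) i r := by
  obtain ⟨r, T, hT, -, -, hreach⟩ := hg
  set D := averagingMatrix g dbar with hD_def
  have hD := averagingMatrix_mem_rowStochastic hd
  have hmul : ∀ (k : ℕ) (i l : Fin N), 0 < D i l → 0 < (D ^ k) l r → 0 < (D ^ (k + 1)) i r := by
    intro k i l h1 h2
    rw [pow_succ', Matrix.mul_apply]
    exact Finset.sum_pos' (fun m _ => mul_nonneg (Matrix.nonneg_of_mem_rowStochastic hD)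
      (Matrix.nonneg_of_mem_rowStochastic (pow_mem hD k))) ⟨l, Finset.mem_univ l, mul_pos h1 h2⟩
  have hmono : ∀ (i : Fin N) (k j : ℕ), 0 < (D ^ k) i r → 0 < (D ^ (k + j)) i r := by
    intro i k j h
    induction j with
    | zero => exact h
    | succ j ih => exact hmul (k + j) i i (averagingMatrix_diag_pos hd i) ih
  have hex : ∀ i, ∃ k, 0 < (D ^ k) i r := by
    intro i
    induction hreach i with
    | refl => exact ⟨0, by simp⟩
    | tail _ hbc ih =>
      obtain ⟨k, hk⟩ := ih
      exact ⟨k + 1, hmul k _ _ (averagingMatrix_pos hd (hT _ _ hbc)) hk⟩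
  choose f hf using hex
  refine ⟨r, Finset.univ.sup f, fun i => ?_⟩
  obtain ⟨j, hj⟩ := Nat.exists_eq_add_of_le (Finset.le_sup (f := f) (Finset.mem_univ i))
  rw [hj]
  exact hmono i _ _ (hf i)

/-- Coupled marginally stable systems with vanishing disturbances reach consensus. -/
theorem tendsto_sub_of_consensus {ι : Type} [Fintype ι] [DecidableEq ι]
    (hg : g.HasDirectedSpanningTree) (hd : ∀ i, g.inDegree i ≤ dbar i) {M : Matrix ι ι ℝ}
    (hM : ∀ z ∈ eigenvalues M, ‖z‖ ≤ 1) {δ e : ℕ → Fin N → ι → ℝ}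
    (hδ : ∀ k i, δ (k + 1) i = M *ᵥ (δ k i - localInfo g dbar (δ k) i + e k i))
    (he : ∀ i, Tendsto (fun k => e k i) atTop (𝓝 0)) (i j : Fin N) :
    Tendsto (fun k => δ k i - δ k j) atTop (𝓝 0) := by
  obtain ⟨r, k₀, hk₀⟩ := exists_averagingMatrix_pow_pos hg hd
  set D := averagingMatrix g dbar with hD_def
  obtain ⟨c, ρ, hc, hρ0, hρ1, hρ⟩ := exists_spread_mix_pow_le (E := ι → ℝ)
    (averagingMatrix_mem_rowStochastic hd) hk₀
  -- The midpoint of `1` and `ρ⁻¹`: above the spectral radius of `M`, yet with `s * ρ = (ρ + 1) / 2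
  -- < 1`.
  set s : ℝ := (1 + ρ⁻¹) / 2 with hs
  have hs1 : 1 < s := by
    have := one_lt_inv₀ hρ0 |>.mpr hρ1
    linarith
  have hsρ : s * ρ = (ρ + 1) / 2 := by
    rw [hs]; field_simp
  obtain ⟨c', hc', hpow⟩ := exists_norm_pow_mulVec_le M (r := s) (by linarith)
    fun z hz => (hM z hz).trans_lt hs1
  let T : Module.End ℝ (Fin N → ι → ℝ) :=
    { toFun := fun v i => M *ᵥ mix D v i
      map_add' := fun v v' => by
        ext1 i
        simp only [mix, Pi.add_apply, smul_add, Finset.sum_add_distrib, Matrix.mulVec_add]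
      map_smul' := fun t v => by
        ext1 i
        simp only [mix, Pi.smul_apply, smul_comm _ t, ← Finset.smul_sum, Matrix.mulVec_smul,
          RingHom.id_apply] }
  -- `M` acts on the values and `D` on the agents, so the two actions commute and powers factor.
  have hT : ∀ (k : ℕ) (v : Fin N → ι → ℝ) (i : Fin N),
      (T ^ k) v i = (M ^ k) *ᵥ mix (D ^ k) v i := by
    intro k
    induction k with
    | zero => intro v i; simp [mix, Matrix.one_apply]
    | succ k ih =>
      intro v i
      rw [pow_succ', Module.End.mul_apply]
      change M *ᵥ (∑ l, D i l • (T ^ k) v l) = _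
      simp only [ih, ← Matrix.mulVec_smul]
      rw [← Matrix.mulVec_sum, Matrix.mulVec_mulVec, ← pow_succ', pow_succ' D, mix_mul]
      rfl
  have hgeo : ∀ (k : ℕ) (v : Fin N → ι → ℝ), spread (Fin N) (ι → ℝ) ((T ^ k) v) ≤
      c' * c * ((ρ + 1) / 2) ^ k * spread (Fin N) (ι → ℝ) v := by
    intro k v
    refine spread_le (mul_nonneg (by positivity) (apply_nonneg _ _)) fun i j => ?_
    rw [hT, hT, ← Matrix.mulVec_sub, ← hsρ, mul_pow]
    calc _ ≤ c' * s ^ k * ‖mix (D ^ k) v i - mix (D ^ k) v j‖ := hpow _ _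
      _ ≤ c' * s ^ k * (c * ρ ^ k * spread (Fin N) (ι → ℝ) v) :=
        mul_le_mul_of_nonneg_left ((norm_sub_le_spread _ i j).trans (hρ k v)) (by positivity)
      _ = _ := by ring
  have hu : Tendsto (fun k => spread (Fin N) (ι → ℝ) fun i => M *ᵥ e k i) atTop (𝓝 0) := by
    have h : Tendsto (fun k (ij : Fin N × Fin N) => M *ᵥ e k ij.1 - M *ᵥ e k ij.2) atTop
        (𝓝 0) := by
      refine tendsto_pi_nhds.mpr fun ij => ?_
      simpa using (tendsto_mulVec_zero M (he ij.1)).sub (tendsto_mulVec_zero M (he ij.2))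
    exact tendsto_zero_iff_norm_tendsto_zero.mp h
  have hlim := tendsto_zero_of_linear_recursion (spread (Fin N) (ι → ℝ)) T (by positivity)
    (by linarith) hgeo (v := δ) (u := fun k i => M *ᵥ e k i) (fun k => by
      ext1 i
      rw [hδ, Matrix.mulVec_add]
      change M *ᵥ (δ k - localInfo g dbar (δ k)) i + _ = _
      rw [sub_localInfo]
      rfl) hu
  rw [tendsto_zero_iff_norm_tendsto_zero]
  exact squeeze_zero (fun k => norm_nonneg _) (fun k => norm_sub_le_spread (δ k) i j) hlim

end Graph

/-! ### Linearity of the localized information. -/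

section LocalInfo

variable {N : ℕ} (g : WeightedDigraph N) (dbar : Fin N → ℝ)

theorem localInfo_mulVec {ν ν' : Type} [Fintype ν] (M : Matrix ν' ν ℝ) (z : Fin N → ν → ℝ)
    (i : Fin N) : localInfo g dbar (fun j => M *ᵥ z j) i = M *ᵥ localInfo g dbar z i := by
  simp only [localInfo, Matrix.mulVec_sum, Matrix.mulVec_smul, Matrix.mulVec_sub]

theorem localInfo_sub {ν : Type} (z z' : Fin N → ν → ℝ) (i : Fin N) :
    localInfo g dbar (fun j => z j - z' j) i = localInfo g dbar z i - localInfo g dbar z' i := by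
  simp only [localInfo, ← Finset.sum_sub_distrib, ← smul_sub]
  exact Finset.sum_congr rfl fun j _ => by congr 1; abel

end LocalInfo

/-! ### Error dynamics of the closed loop. -/

section Synchronization

variable {n m p w : ℕ} {P : AgentModel n m p w}

/-- Synchronization of agents `ξ⁺ = A ξ - B K χ`, `y = C ξ` with the observers of the design. -/
theorem tendsto_sub_of_observer {ι μ π : Type} [Fintype ι] [DecidableEq ι] [Fintype μ] [Fintype π]
    {N : ℕ} {g : WeightedDigraph N} {dbar : Fin N → ℝ} (hg : g.HasDirectedSpanningTree)
    (hd : ∀ i, g.inDegree i ≤ dbar i) {A : Matrix ι ι ℝ} {B : Matrix ι μ ℝ} {C : Matrix π ι ℝ}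
    {K : Matrix μ ι ℝ} {H : Matrix ι π ℝ} (hA : ∀ z ∈ eigenvalues A, ‖z‖ ≤ 1)
    (hK : IsSchur (A - B * K)) (hH : IsSchur (A - H * C)) {ξ xh χ : ℕ → Fin N → ι → ℝ}
    (hξ : ∀ k i, ξ (k + 1) i = A *ᵥ ξ k i - (B * K) *ᵥ χ k i)
    (hxh : ∀ k i, xh (k + 1) i = (A - H * C) *ᵥ xh k i +
      H *ᵥ localInfo g dbar (fun j => C *ᵥ ξ k j) i - (B * K) *ᵥ localInfo g dbar (χ k) i)
    (hχ : ∀ k i, χ (k + 1) i = A *ᵥ xh k i + (A - B * K) *ᵥ χ k i -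
      A *ᵥ localInfo g dbar (χ k) i) (i j : Fin N) :
    Tendsto (fun k => ξ k i - ξ k j) atTop (𝓝 0) := by
  -- The protocol state `xh` observes the localized information of `ξ`, not `ξ` itself; the
  -- exchanged term in `χ` cancels from the error, leaving `A - H C`.
  have he : ∀ i, Tendsto (fun k => localInfo g dbar (ξ k) i - xh k i) atTop (𝓝 0) := by
    intro i
    refine hH.tendsto_zero (u := fun _ => 0) (fun k => ?_) tendsto_const_nhds
    have h1 : localInfo g dbar (ξ (k + 1)) i =
        A *ᵥ localInfo g dbar (ξ k) i - (B * K) *ᵥ localInfo g dbar (χ k) i := by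
      rw [← localInfo_mulVec, ← localInfo_mulVec, ← localInfo_sub]
      exact congrArg (fun z => localInfo g dbar z i) (funext (hξ k))
    rw [h1, hxh, localInfo_mulVec]
    simp only [Matrix.sub_mulVec, Matrix.mulVec_sub, Matrix.mulVec_mulVec]
    abel
  -- The feedback terms `B K χ` cancel in `ξ - χ`, and `xh` is the localized information of `ξ`
  -- minus the observer error.
  have hδ := tendsto_sub_of_consensus hg hd hA (δ := fun k i => ξ k i - χ k i)
    (e := fun k i => localInfo g dbar (ξ k) i - xh k i) (fun k i => by
      rw [localInfo_sub, hξ, hχ]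
      simp only [Matrix.sub_mulVec, Matrix.mulVec_sub, Matrix.mulVec_add]
      abel) he i j
  -- Writing `χ = ξ - δ` closes the loop: `ξ⁺ = (A - B K) ξ + B K δ` for each agent, hence for
  -- differences.
  refine hK.tendsto_zero (fun k => ?_) (tendsto_mulVec_zero (B * K) hδ)
  rw [hξ, hξ]
  simp only [Matrix.sub_mulVec, Matrix.mulVec_sub]
  abel

theorem achievesScalableSync_overallProtocol (hP : P.Assumptions)
    {Pi : Matrix (Fin n) (Fin w) ℝ} {Gam : Matrix (Fin m) (Fin w) ℝ}
    (hR : RegulationEquations P Pi Gam) (Bp : Matrix (Fin w) (Fin m) ℝ)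
    (Dp : Matrix (Fin m) (Fin m) ℝ) {K : Matrix (Fin m) (Fin n ⊕ Fin w) ℝ}
    {H : Matrix (Fin n ⊕ Fin w) (Fin p) ℝ}
    (hK : IsSchur (cascadeA P Gam - cascadeB P Bp Dp * K))
    (hH : IsSchur (cascadeA P Gam - H * cascadeC P)) :
    AchievesScalableSync P (overallProtocol P Gam Bp Dp K H) := by
  intro N g hg dbar hd x xc ω htraj i j
  have hA : ∀ z ∈ eigenvalues (cascadeA P Gam), ‖z‖ ≤ 1 := by
    intro z hz
    rw [cascadeA, eigenvalues_fromBlocks_zero] at hz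
    exact hz.elim (hP.weakly_unstable z) fun h => (hP.exosystem_unit_circle z h).le
  obtain ⟨q, hq⟩ : ∃ q : ℕ → Fin N → Fin w → ℝ, ∀ k i, q k i = fun l => xc k i (Sum.inl l) :=
    ⟨_, fun _ _ => rfl⟩
  obtain ⟨xh, hxh⟩ : ∃ xh : ℕ → Fin N → Fin n ⊕ Fin w → ℝ,
    ∀ k i, xh k i = fun l => xc k i (Sum.inr (Sum.inl l)) := ⟨_, fun _ _ => rfl⟩
  obtain ⟨χ, hχ⟩ : ∃ χ : ℕ → Fin N → Fin n ⊕ Fin w → ℝ,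
    ∀ k i, χ k i = fun l => xc k i (Sum.inr (Sum.inr l)) := ⟨_, fun _ _ => rfl⟩
  have hxc : ∀ k i, xc k i = Sum.elim (q k i) (Sum.elim (xh k i) (χ k i)) := by
    intro k i
    rw [hq, hxh, hχ]
    ext (l | l | l) <;> rfl
  have hM : ∀ k i, (overallProtocol P Gam Bp Dp K H).Mc *ᵥ xc k i = χ k i := by
    intro k i
    rw [hxc]
    simp only [overallProtocol, Matrix.fromCols_mulVec, Sum.elim_comp_inl, Sum.elim_comp_inr,
      Matrix.zero_mulVec, Matrix.one_mulVec, zero_add]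
  have hF : ∀ k i, (overallProtocol P Gam Bp Dp K H).Fc *ᵥ xc k i =
      Gam *ᵥ q k i - (Dp * K) *ᵥ χ k i := by
    intro k i
    rw [hxc]
    simp only [overallProtocol, Matrix.fromCols_mulVec, Sum.elim_comp_inl, Sum.elim_comp_inr,
      Matrix.zero_mulVec, Matrix.neg_mulVec, zero_add, sub_eq_add_neg]
  -- Deviation from the regulated motion `x = Π ω`, `p = ω`, on which the output is zero.
  set ξ : ℕ → Fin N → Fin n ⊕ Fin w → ℝ := fun k i =>
    Sum.elim (x k i - Pi *ᵥ ω k i) (q k i - ω k i) with hξ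
  have hy : ∀ k i, P.output (x k i) (ω k i) = cascadeC P *ᵥ ξ k i := by
    intro k i
    have h2 : P.G = -(P.C * Pi) := eq_neg_of_add_eq_zero_right hR.2
    simp only [AgentModel.output, cascadeC, hξ, Matrix.fromCols_mulVec, Sum.elim_comp_inl,
      Sum.elim_comp_inr, Matrix.zero_mulVec, add_zero, Matrix.mulVec_sub, h2, Matrix.neg_mulVec,
      Matrix.mulVec_mulVec, ← sub_eq_add_neg, sub_zero]
  have hstep := htraj.protocol
  simp only [hM, hy] at hstep
  have hstep' : ∀ k i, xc (k + 1) i = Sum.elim (P.S *ᵥ q k i - (Bp * K) *ᵥ χ k i)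
      (Sum.elim ((cascadeA P Gam - H * cascadeC P) *ᵥ xh k i +
          H *ᵥ localInfo g dbar (fun j => cascadeC P *ᵥ ξ k j) i -
          (cascadeB P Bp Dp * K) *ᵥ localInfo g dbar (χ k) i)
        (cascadeA P Gam *ᵥ xh k i + (cascadeA P Gam - cascadeB P Bp Dp * K) *ᵥ χ k i -
          cascadeA P Gam *ᵥ localInfo g dbar (χ k) i)) := by
    intro k i
    rw [hstep, hxc]
    simp only [overallProtocol, Matrix.fromBlocks_mulVec, Matrix.fromRows_mulVec,
      Matrix.fromCols_mulVec, Sum.elim_comp_inl, Sum.elim_comp_inr, Matrix.zero_mulVec,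
      Matrix.neg_mulVec, zero_add, add_zero]
    ext (l | l | l) <;> simp [sub_eq_add_neg]
  have hqs : ∀ k i, q (k + 1) i = P.S *ᵥ q k i - (Bp * K) *ᵥ χ k i := fun k i => by
    rw [hq, hstep']; rfl
  have hξs : ∀ k i, ξ (k + 1) i =
      cascadeA P Gam *ᵥ ξ k i - (cascadeB P Bp Dp * K) *ᵥ χ k i := by
    intro k i
    have hx : x (k + 1) i - Pi *ᵥ ω (k + 1) i =
        P.A *ᵥ (x k i - Pi *ᵥ ω k i) + (P.B * Gam) *ᵥ (q k i - ω k i) -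
          (P.B * Dp * K) *ᵥ χ k i := by
      rw [htraj.agent, htraj.exosystem, hF, Matrix.mulVec_mulVec, hR.1]
      simp only [Matrix.mulVec_sub, Matrix.add_mulVec, Matrix.mulVec_mulVec, Matrix.mul_assoc]
      abel
    have hq' : q (k + 1) i - ω (k + 1) i = P.S *ᵥ (q k i - ω k i) - (Bp * K) *ᵥ χ k i := by
      rw [hqs, htraj.exosystem, Matrix.mulVec_sub]
      abel
    simp only [hξ]
    rw [hx, hq', cascadeA, cascadeB, Matrix.fromRows_mul, Matrix.fromRows_mulVec,
      Matrix.fromBlocks_mulVec]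
    simp only [Sum.elim_comp_inl, Sum.elim_comp_inr, Matrix.zero_mulVec, zero_add]
    ext (l | l) <;> rfl
  have hlim := tendsto_sub_of_observer hg hd hA hK hH hξs (xh := xh) (χ := χ)
    (fun k i => by rw [hxh, hstep']; rfl) (fun k i => by rw [hχ, hstep']; rfl) i j
  simp only [hy, ← Matrix.mulVec_sub]
  exact tendsto_mulVec_zero _ hlim

/-- The protocol with relabelled state and exchanged variable. -/
def LinearProtocol.reindex {κ ν κ' ν' : Type} (Q : LinearProtocol m p κ ν) (e : κ ≃ κ')
    (f : ν ≃ ν') : LinearProtocol m p κ' ν' where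
  Ac := Q.Ac.submatrix e.symm e.symm
  Bc := Q.Bc.submatrix e.symm id
  Cc := Q.Cc.submatrix e.symm f.symm
  Fc := Q.Fc.submatrix id e.symm
  Mc := Q.Mc.submatrix f.symm e.symm

theorem localInfo_comp {N : ℕ} (g : WeightedDigraph N) (dbar : Fin N → ℝ) {ν ν' : Type}
    (f : ν' → ν) (z : Fin N → ν → ℝ) (i : Fin N) :
    localInfo g dbar (fun j => z j ∘ f) i = localInfo g dbar z i ∘ f := by
  ext l
  simp [localInfo]

theorem AchievesScalableSync.reindex {κ ν κ' ν' : Type} [Fintype κ] [Fintype ν] [Fintype κ']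
    [Fintype ν'] {Q : LinearProtocol m p κ ν} (hQ : AchievesScalableSync P Q) (e : κ ≃ κ')
    (f : ν ≃ ν') : AchievesScalableSync P (Q.reindex e f) := by
  intro N g hg dbar hd x xc ω h
  -- Relabelling the state back turns a trajectory of the new protocol into one of `Q` with the same
  -- agents.
  refine hQ N g hg dbar hd x (fun k i => xc k i ∘ e) ω ⟨h.exosystem, fun k i => ?_, fun k i => ?_⟩
  · rw [h.agent, LinearProtocol.reindex, Matrix.submatrix_mulVec_equiv, Equiv.symm_symm,
      Function.comp_id]
  · have hM : ∀ j, (Q.reindex e f).Mc *ᵥ xc k j = (Q.Mc *ᵥ (xc k j ∘ e)) ∘ f.symm := fun j => by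
      rw [LinearProtocol.reindex, Matrix.submatrix_mulVec_equiv, Equiv.symm_symm]
    have hB : ∀ v, (Q.reindex e f).Bc *ᵥ v = (Q.Bc *ᵥ v) ∘ e.symm := fun v =>
      Matrix.submatrix_mulVec_equiv Q.Bc v e.symm (Equiv.refl _)
    have hA : ∀ v, (Q.reindex e f).Ac *ᵥ v = (Q.Ac *ᵥ (v ∘ e)) ∘ e.symm := fun v => by
      rw [LinearProtocol.reindex, Matrix.submatrix_mulVec_equiv, Equiv.symm_symm]
    have hC : ∀ v, (Q.reindex e f).Cc *ᵥ v = (Q.Cc *ᵥ (v ∘ f)) ∘ e.symm := fun v => by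
      rw [LinearProtocol.reindex, Matrix.submatrix_mulVec_equiv, Equiv.symm_symm]
    rw [h.protocol]
    simp only [hM, hA, hB, hC, localInfo_comp]
    ext l
    simp [Function.comp_assoc]

end Synchronization

end ScalableSync

theorem theorem1 {n m p w : ℕ} (P : ScalableSync.AgentModel n m p w) (hP : P.Assumptions) :
    ScalableSync.ScalableSyncSolvable P ∧
    (∃ (Pi : Matrix (Fin n) (Fin w) ℝ) (Gam : Matrix (Fin m) (Fin w) ℝ),
      ScalableSync.RegulationEquations P Pi Gam) ∧
    ∀ (Pi : Matrix (Fin n) (Fin w) ℝ) (Gam : Matrix (Fin m) (Fin w) ℝ),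
      ScalableSync.RegulationEquations P Pi Gam →
      (∃ (Bp : Matrix (Fin w) (Fin m) ℝ) (Dp : Matrix (Fin m) (Fin m) ℝ),
        ScalableSync.AdmissiblePrecompensator P Gam Bp Dp) ∧
      ∀ (Bp : Matrix (Fin w) (Fin m) ℝ) (Dp : Matrix (Fin m) (Fin m) ℝ),
        ScalableSync.AdmissiblePrecompensator P Gam Bp Dp →
        (∃ (K : Matrix (Fin m) (Fin n ⊕ Fin w) ℝ) (H : Matrix (Fin n ⊕ Fin w) (Fin p) ℝ),
          ScalableSync.IsSchur
            (ScalableSync.cascadeA P Gam - ScalableSync.cascadeB P Bp Dp * K) ∧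
          ScalableSync.IsSchur
            (ScalableSync.cascadeA P Gam - H * ScalableSync.cascadeC P)) ∧
        ∀ (K : Matrix (Fin m) (Fin n ⊕ Fin w) ℝ) (H : Matrix (Fin n ⊕ Fin w) (Fin p) ℝ),
          ScalableSync.IsSchur
            (ScalableSync.cascadeA P Gam - ScalableSync.cascadeB P Bp Dp * K) →
          ScalableSync.IsSchur
            (ScalableSync.cascadeA P Gam - H * ScalableSync.cascadeC P) →
          ScalableSync.AchievesScalableSync P
            (ScalableSync.overallProtocol P Gam Bp Dp K H) := by
  obtain ⟨Pi, Gam, hR⟩ := hP.exists_regulation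
  have hpre := fun Pi Gam (h : ScalableSync.RegulationEquations P Pi Gam) =>
    hP.exists_precompensator h
  have hKH : ∀ Pi Gam, ScalableSync.RegulationEquations P Pi Gam → ∀ Bp Dp,
      ScalableSync.AdmissiblePrecompensator P Gam Bp Dp →
      ∃ (K : Matrix (Fin m) (Fin n ⊕ Fin w) ℝ) (H : Matrix (Fin n ⊕ Fin w) (Fin p) ℝ),
        ScalableSync.IsSchur (ScalableSync.cascadeA P Gam - ScalableSync.cascadeB P Bp Dp * K) ∧
        ScalableSync.IsSchur (ScalableSync.cascadeA P Gam - H * ScalableSync.cascadeC P) := by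
    intro Pi Gam h Bp Dp hadm
    obtain ⟨K, hK⟩ := hadm.stabilizable_cascade hP.stabilizable
    obtain ⟨H, hH⟩ := hP.detectable_cascade h
    exact ⟨K, H, hK, hH⟩
  refine ⟨?_, ⟨Pi, Gam, hR⟩, fun Pi' Gam' h => ⟨hpre _ _ h, fun Bp Dp hadm =>
    ⟨hKH _ _ h Bp Dp hadm, fun K H hK hH =>
      ScalableSync.achievesScalableSync_overallProtocol hP h Bp Dp hK hH⟩⟩⟩
  obtain ⟨Bp, Dp, hadm⟩ := hpre Pi Gam hR
  obtain ⟨K, H, hK, hH⟩ := hKH Pi Gam hR Bp Dp hadm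
  -- Solvability asks for protocol spaces indexed by `Fin`, so the sum types of the design are
  -- relabelled.
  exact ⟨_, _, _, (ScalableSync.achievesScalableSync_overallProtocol hP hR Bp Dp hK hH).reindex
    (Fintype.equivFin _) (Fintype.equivFin _)⟩
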